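/- Let $n\ge 1$ and $n-1<d<n$. Write $Q(x,r)=\{y\in\mathbb{R}^n:\max_i|y_i-x_i|\le r\}$ and let $S\subset\mathbb{R}^n$ be an (Ahlfors) $d$-set: $S$ is closed and there are $c_1,c_2>0$ with $c_1r^d\le\mathcal{H}^d(Q(w,r)\cap S)\le c_2r^d$ for all $w\in S$, $0<r\le1$. Here $\mathcal{H}^d$ is the $d$-dimensional Hausdorff measure; $L^p(S)$ is taken with respect to $\mathcal{H}^d|_S$. For an integer $k\ge1$ and $1\le u<\infty$, let $\mathcal{P}_{k-1}$ be the space of real polynomials on $\mathbb{R}^n$ of degree at most $k-1$, and put $$\mathcal{E}_k(f,Q)_{L^u(\mathbb{R}^n)}=\inf_{P\in\mathcal{P}_{k-1}}\Big(\frac1{|Q|}\int_Q|f-P|^u\,dx\Big)^{1/u},\qquad \mathcal{E}_k(g,Q)_{L^u(S)}=\inf_{P\in\mathcal{P}_{k-1}}\Big(\frac1{\mathcal{H}^d(Q\cap S)}\int_{Q\cap S}|g-P|^u\,d\mathcal{H}^d\Big)^{1/u}$$ (the latter for cubes centred in $S$). For $\alpha>0$ and $1\le p,q<\infty$, the Besov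 space $B^\alpha_{pq}(\mathbb{R}^n)$ consists of the real functions $f\in L^p(\mathbb{R}^n)$ with $$\int_0^1\Big(t^{-\alpha}\big\|\mathcal{E}_k(f,Q(\cdot,t))_{L^u(\mathbb{R}^n)}\big\|_{L^p(\mathbb{R}^n)}\Big)^q\frac{dt}{t}<\infty$$ for some integer $k>\alpha$ and some $1\le u\le p$ (it is known that the space does not depend on this choice). The pointwise trace of $f\in L^1_{\mathrm{loc}}(\mathbb{R}^n)$ is $f|_S(x)=\lim_{r\to0+}\frac1{|Q(x,r)|}\int_{Q(x,r)}f(y)\,dy$ at those $x\in S$ where the limit exists. **Theorem.** Let $S$ be a $d$-set in $\mathbb{R}^n$ with $n-1<d<n$, let $1\le p,q<\infty$, $\alpha>(n-d)/p$, $1\le u\le p$, and let $k>\alpha$ be an integer. There is a constant $C>0$, depending only on $S,n,d,p,q,\alpha,u,k$, such that for every $f\in B^\alpha_{pq}(\mathbb{R}^n)$ the trace $f|_S$ is defined $\mathcal{H}^d$-almost everywhere on $S$, belongs to $L^p(S)$, and satisfies $$\Big(\sum_{i\ge0}\big(2^{i(\alpha-(n-d)/p)}\|\mathcal{E}_k(f|_S,Q(\cdot,2^{-i}))_{L^u(S)}\|_{L^p(S)}\big)^q\Big)^{1/q}+\|f|_S\|_{L^p(S)}$$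 $$\le C\Big\{\Big(\sum_{j\ge0}\big(2^{j\alpha}\|\mathcal{E}_k(f,Q(\cdot,2^{-j}))_{L^u(\mathbb{R}^n)}\|_{L^p(\mathbb{R}^n)}\big)^q\Big)^{1/q}+\|f\|_{L^p(\mathbb{R}^n)}\Big\}.$$ -/

import Mathlib

open MeasureTheory Filter Topology Set
open scoped ENNReal

noncomputable section

/-- The closed cube `Q(x, r)` in `ℝⁿ` with centre `x`, side length `2r`, and sides parallel to the
coordinate axes. -/
def cube {n : ℕ} (x : EuclideanSpace ℝ (Fin n)) (r : ℝ) : Set (EuclideanSpace ℝ (Fin n)) :=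
  {y | ∀ i, |y i - x i| ≤ r}

/-- `S` is an (Ahlfors) `d`-set in `ℝⁿ`, `0 < d ≤ n`. -/
def IsDSet {n : ℕ} (d : ℝ) (S : Set (EuclideanSpace ℝ (Fin n))) : Prop :=
  0 < d ∧ d ≤ n ∧ IsClosed S ∧
    ∃ c₁ c₂ : ℝ, 0 < c₁ ∧ 0 < c₂ ∧ ∀ w ∈ S, ∀ r : ℝ, 0 < r → r ≤ 1 →
      ENNReal.ofReal (c₁ * r ^ d) ≤ Measure.hausdorffMeasure d (cube w r ∩ S) ∧
      Measure.hausdorffMeasure d (cube w r ∩ S) ≤ ENNReal.ofReal (c₂ * r ^ d)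

/-- The natural measure on `S`: the restriction to `S` of the `d`-dimensional Hausdorff measure. -/
def setMeasure {n : ℕ} (d : ℝ) (S : Set (EuclideanSpace ℝ (Fin n))) :
    Measure (EuclideanSpace ℝ (Fin n)) :=
  (Measure.hausdorffMeasure d).restrict S

/-- The real polynomials in `n` variables of degree at most `k - 1`; only the zero polynomial
when `k = 0`. -/
def polys (n k : ℕ) : Set (MvPolynomial (Fin n) ℝ) :=
  {P | P = 0 ∨ P.totalDegree < k}

/-- The normalized local best approximation of `g` on `A` in `L^u(μ)` by polynomials of degree at
most `k - 1`, as an element of `[0, ∞]`. For `μ` the Lebesgue measure and `A = Q` a cube it is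
`𝓔_k(g, Q)_{L^u(ℝⁿ)}`; for `μ` the Hausdorff measure restricted to `S` it is
`𝓔_k(g, Q)_{L^u(S)}`, since then `μ Q` is the measure of `Q ∩ S` and the integral is over
`Q ∩ S`. -/
def localApprox {n : ℕ} (μ : Measure (EuclideanSpace ℝ (Fin n))) (k : ℕ) (u : ℝ)
    (g : EuclideanSpace ℝ (Fin n) → ℝ) (A : Set (EuclideanSpace ℝ (Fin n))) : ℝ≥0∞ :=
  ⨅ P ∈ polys n k,
    ((μ A)⁻¹ * ∫⁻ y in A, ‖g y - MvPolynomial.eval (fun i => y i) P‖ₑ ^ u ∂μ) ^ (1 / u)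

/-- The `L^p(μ)` norm of `x ↦ 𝓔_k(g, Q(x, t))_{L^u(μ)}`. -/
def approxNorm {n : ℕ} (μ : Measure (EuclideanSpace ℝ (Fin n))) (k : ℕ) (u p : ℝ)
    (g : EuclideanSpace ℝ (Fin n) → ℝ) (t : ℝ) : ℝ≥0∞ :=
  (∫⁻ x, localApprox μ k u g (cube x t) ^ p ∂μ) ^ (1 / p)

/-- The discretized Besov seminorm
`(∑_{j ≥ 0} (2^{j s} ‖𝓔_k(g, Q(·, 2^{-j}))_{L^u(μ)}‖_{L^p(μ)})^q)^{1/q}`, in `[0, ∞]`. -/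
def discreteBesov {n : ℕ} (μ : Measure (EuclideanSpace ℝ (Fin n))) (k : ℕ) (u p q s : ℝ)
    (g : EuclideanSpace ℝ (Fin n) → ℝ) : ℝ≥0∞ :=
  (∑' j : ℕ, (ENNReal.ofReal ((2 : ℝ) ^ ((j : ℝ) * s)) *
    approxNorm μ k u p g ((2 : ℝ) ^ (-(j : ℝ)))) ^ q) ^ (1 / q)

/-- `f` belongs to the Besov space `B^α_{pq}(ℝⁿ)` (`α > 0`, `1 ≤ p, q < ∞`): `f ∈ L^p(ℝⁿ)` and
`∫_0^1 (t^{-α} ‖𝓔_k(f, Q(·, t))_{L^u(ℝⁿ)}‖_{L^p(ℝⁿ)})^q dt/t < ∞`.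
The space does not depend on the admissible parameters `k > α`, `1 ≤ u ≤ p`; membership asks for
the condition for some admissible choice. -/
def MemBesov {n : ℕ} (α p q : ℝ) (f : EuclideanSpace ℝ (Fin n) → ℝ) : Prop :=
  MemLp f (ENNReal.ofReal p) volume ∧
    ∃ (k : ℕ) (u : ℝ), α < k ∧ 1 ≤ u ∧ u ≤ p ∧
      ∫⁻ t in Ioc (0 : ℝ) 1,
        (ENNReal.ofReal (t ^ (-α)) * approxNorm volume k u p f t) ^ q * ENNReal.ofReal t⁻¹ < ∞

/-- `l` is the limit of the averages of `f` over the cubes `Q(x, r)` as `r → 0+`. -/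
def HasTraceAt {n : ℕ} (f : EuclideanSpace ℝ (Fin n) → ℝ) (x : EuclideanSpace ℝ (Fin n))
    (l : ℝ) : Prop :=
  Tendsto (fun r : ℝ => ⨍ y in cube x r, f y) (𝓝[>] 0) (𝓝 l)

open Classical in
/-- The pointwise trace of `f`: the limit of the averages of `f` over `Q(x, r)` as `r → 0+` at the
points `x` where it exists (and `0` elsewhere). -/
def trace {n : ℕ} (f : EuclideanSpace ℝ (Fin n) → ℝ) (x : EuclideanSpace ℝ (Fin n)) : ℝ :=
  if h : ∃ l, HasTraceAt f x l then h.choose else 0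

end

/-!
Why the trace theorem holds. On the cube `Q = Q(0, 1)` the bilinear form `∫_Q P R` is positive
definite on polynomials of bounded degree, so every coefficient functional is integration against a
continuous kernel (`exists_coeff_kernel`). Applied to the rescaled functions `f(y + 2^{-j} z)`, the
kernels give a projection of `f` onto polynomials near `y` at scale `2^{-j}` that is linear in `f`.
Any functional that vanishes on polynomials is bounded by the local best approximation; hence the
values at `y` of the projections at consecutive scales differ by at most a multiple of
`𝓔_k(f, Q(y, 2^{-j}))`, while the nonconstant coefficients are halved, up to the same error,
when the scale is halved. If the local approximations at `y` are summable, the values converge, the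
nonconstant coefficients tend to zero, and the averages of `f` over all small cubes at `y` converge
to the same limit, at the rate of the tail sum (`CoeffKernels.exists_hasTraceAt`).

On the `d`-set, `𝓔_k(f, Q(y, 2^{-j-1}))` is at most a constant times `𝓔_k(f, Q(z, 2^{-j}))` for all
`z` in `Q(y, 2^{-j-1})`. Averaging over `z` and integrating over `y` with Tonelli's theorem, the
bound `r^d` for the measure of cubes gives
`‖𝓔_k(f, Q(·, 2^{-j-1}))‖_{L^p(S)} ≤ C 2^{j(n-d)/p} ‖𝓔_k(f, Q(·, 2^{-j}))‖_{L^p(ℝⁿ)}`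
(`RegularOn.dyadicNorm_succ_le`). As `α > (n - d)/p` these norms are summable, so the trace exists
almost everywhere and lies in `L^p(S)` (`exists_measurable_trace`, `RegularOn.norm_limit_le`).
For the seminorm, a polynomial that is close to `f` on `Q(x, 2^{1-i})` is close to the trace on
`Q(x, 2^{-i}) ∩ S`, up to the tail sum of the finer local approximations
(`RegularOn.localApprox_limit_le`), and the sum over scales is controlled by a discrete Hardy
inequality (`tsum_rpow_tsum_shift_le`). Only estimates of polynomials on full cubes of `ℝⁿ` occur;
in this direction no Markov inequality on `S` is needed.
-/

/-! ### Cubes and rescaling -/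

/-- Lebesgue measure restricted to the cube `Q(0, 1)`, the reference cube to which all others are
rescaled. -/
noncomputable abbrev cubeVol (n : ℕ) : Measure (EuclideanSpace ℝ (Fin n)) :=
  volume.restrict (cube 0 1)

section Cubes

variable {n : ℕ}

lemma isClosed_setOf_mem_cube (r : ℝ) :
    IsClosed {w : EuclideanSpace ℝ (Fin n) × EuclideanSpace ℝ (Fin n) | w.2 ∈ cube w.1 r} := by
  have h : {w : EuclideanSpace ℝ (Fin n) × EuclideanSpace ℝ (Fin n) | w.2 ∈ cube w.1 r} =
      ⋂ i, {w | |w.2 i - w.1 i| ≤ r} := by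
    ext w
    simp [cube]
  rw [h]
  refine isClosed_iInter fun i => isClosed_le ?_ continuous_const
  fun_prop

lemma isClosed_cube (x : EuclideanSpace ℝ (Fin n)) (r : ℝ) : IsClosed (cube x r) :=
  (isClosed_setOf_mem_cube r).preimage (Continuous.prodMk_right x)

lemma measurableSet_cube (x : EuclideanSpace ℝ (Fin n)) (r : ℝ) : MeasurableSet (cube x r) :=
  (isClosed_cube x r).measurableSet

lemma mem_cube_comm {x y : EuclideanSpace ℝ (Fin n)} {r : ℝ} : y ∈ cube x r ↔ x ∈ cube y r := by
  simp only [cube, mem_ofPred_eq, abs_sub_comm]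

lemma isCompact_cube (x : EuclideanSpace ℝ (Fin n)) (r : ℝ) : IsCompact (cube x r) := by
  have h : cube x r = (EuclideanSpace.equiv (Fin n) ℝ).toHomeomorph ⁻¹'
      (Set.pi univ fun i => Icc (x i - r) (x i + r)) := by
    ext y
    simp only [cube, mem_ofPred_eq, mem_preimage, mem_univ_pi, mem_Icc, abs_le]
    refine forall_congr' fun i => ?_
    change _ ↔ x i - r ≤ y i ∧ y i ≤ x i + r
    constructor <;> rintro ⟨h₁, h₂⟩ <;> constructor <;> linarith
  rw [h]
  exact (EuclideanSpace.equiv (Fin n) ℝ).toHomeomorph.isCompact_preimage.2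
    (isCompact_univ_pi fun i => isCompact_Icc)

lemma cube_subset_cube {x y : EuclideanSpace ℝ (Fin n)} {r s t : ℝ} (h : y ∈ cube x s)
    (hr : s + r ≤ t) : cube y r ⊆ cube x t := by
  intro z hz i
  have h₁ := abs_sub_le (z i) (y i) (x i)
  have h₂ := h i
  have h₃ := hz i
  linarith

lemma mem_cube_self (x : EuclideanSpace ℝ (Fin n)) {r : ℝ} (hr : 0 ≤ r) : x ∈ cube x r := by
  intro i; simpa using hr

lemma cube_mono (x : EuclideanSpace ℝ (Fin n)) {r s : ℝ} (h : r ≤ s) : cube x r ⊆ cube x s :=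
  fun _ hz i => (hz i).trans h

lemma closedBall_subset_cube (x : EuclideanSpace ℝ (Fin n)) (r : ℝ) :
    Metric.closedBall x r ⊆ cube x r := by
  intro y hy i
  rw [mem_closedBall_iff_norm] at hy
  exact (PiLp.norm_apply_le (y - x) i).trans hy

lemma cube_mem_nhds (x : EuclideanSpace ℝ (Fin n)) {r : ℝ} (hr : 0 < r) : cube x r ∈ 𝓝 x :=
  mem_of_superset (Metric.closedBall_mem_nhds x hr) (closedBall_subset_cube x r)

instance : IsFiniteMeasure (cubeVol n) :=
  ⟨by simpa using (isCompact_cube 0 1).measure_lt_top⟩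

lemma cubeVol_univ_pos : 0 < cubeVol n univ := by
  rw [Measure.restrict_apply_univ]
  exact (Metric.measure_closedBall_pos volume _ one_pos).trans_le
    (measure_mono (closedBall_subset_cube _ _))

lemma preimage_affine_cube (y : EuclideanSpace ℝ (Fin n)) {r : ℝ} (hr : 0 < r) :
    (fun z => y + r • z) ⁻¹' cube y r = cube 0 1 := by
  ext z
  simp [cube, abs_mul, abs_of_pos hr, hr]

lemma restrict_cube_eq_map (y : EuclideanSpace ℝ (Fin n)) {r : ℝ} (hr : 0 < r) :
    volume.restrict (cube y r) =
      ENNReal.ofReal (r ^ n) • (cubeVol n).map (fun z => y + r • z) := by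
  have hm : Measurable fun z : EuclideanSpace ℝ (Fin n) => y + r • z := by fun_prop
  have h : (volume : Measure (EuclideanSpace ℝ (Fin n))).map (fun z => y + r • z) =
      ENNReal.ofReal (r ^ n)⁻¹ • volume := by
    have h₁ := Measure.map_addHaar_smul (volume : Measure (EuclideanSpace ℝ (Fin n))) hr.ne'
    rw [finrank_euclideanSpace_fin, abs_of_pos (by positivity)] at h₁
    have h₂ : (fun z : EuclideanSpace ℝ (Fin n) => y + r • z) = (fun z => y + z) ∘ (r • ·) := rfl
    rw [h₂, ← Measure.map_map (measurable_const_add y) (measurable_const_smul r), h₁,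
      Measure.map_smul, map_add_left_eq_self]
  rw [cubeVol, ← preimage_affine_cube y hr, ← Measure.restrict_map hm (measurableSet_cube y r), h,
    Measure.restrict_smul, smul_smul, ← ENNReal.ofReal_mul (by positivity),
    mul_inv_cancel₀ (by positivity), ENNReal.ofReal_one, one_smul]

lemma lintegral_cube (y : EuclideanSpace ℝ (Fin n)) {r : ℝ} (hr : 0 < r)
    {F : EuclideanSpace ℝ (Fin n) → ℝ≥0∞} (hF : Measurable F) :
    ∫⁻ x in cube y r, F x = ENNReal.ofReal (r ^ n) * ∫⁻ z, F (y + r • z) ∂cubeVol n := by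
  rw [restrict_cube_eq_map y hr, lintegral_smul_measure, lintegral_map hF (by fun_prop),
    smul_eq_mul]

lemma volume_cube (y : EuclideanSpace ℝ (Fin n)) {r : ℝ} (hr : 0 < r) :
    volume (cube y r) = ENNReal.ofReal (r ^ n) * cubeVol n univ := by
  simpa using lintegral_cube y hr (F := fun _ => 1) measurable_const

lemma inv_volume_mul_lintegral_cube (y : EuclideanSpace ℝ (Fin n)) {r : ℝ} (hr : 0 < r)
    {F : EuclideanSpace ℝ (Fin n) → ℝ≥0∞} (hF : Measurable F) :
    (volume (cube y r))⁻¹ * ∫⁻ x in cube y r, F x =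
      (cubeVol n univ)⁻¹ * ∫⁻ z, F (y + r • z) ∂cubeVol n := by
  have h₀ : ENNReal.ofReal (r ^ n) ≠ 0 := by simpa using pow_pos hr n
  rw [lintegral_cube y hr hF, volume_cube y hr,
    ENNReal.mul_inv (Or.inl h₀) (Or.inl ENNReal.ofReal_ne_top), mul_mul_mul_comm,
    ENNReal.inv_mul_cancel h₀ ENNReal.ofReal_ne_top, one_mul]

lemma setAverage_cube (y : EuclideanSpace ℝ (Fin n)) {r : ℝ} (hr : 0 < r)
    (f : EuclideanSpace ℝ (Fin n) → ℝ) :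
    ⨍ x in cube y r, f x = ⨍ z, f (y + r • z) ∂cubeVol n := by
  have he : MeasurableEmbedding fun z : EuclideanSpace ℝ (Fin n) => y + r • z :=
    (measurableEmbedding_addLeft y).comp (measurableEmbedding_const_smul₀ hr.ne')
  have h₀ : (r ^ n : ℝ) ≠ 0 := by positivity
  rw [average_eq, average_eq, restrict_cube_eq_map y hr, integral_smul_measure,
    he.integral_map, measureReal_ennreal_smul_apply, map_measureReal_apply he.measurable .univ,
    ENNReal.toReal_ofReal (by positivity), preimage_univ]
  simp only [smul_eq_mul]
  field_simp

lemma lintegral_comp_smul_le {c : ℝ} (hc : 0 < c) (hc₁ : c ≤ 1)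
    {F : EuclideanSpace ℝ (Fin n) → ℝ≥0∞} (hF : Measurable F) :
    ∫⁻ z, F (c • z) ∂cubeVol n ≤ ENNReal.ofReal ((c ^ n)⁻¹) * ∫⁻ z, F z ∂cubeVol n := by
  have h := lintegral_cube (0 : EuclideanSpace ℝ (Fin n)) hc hF
  simp only [zero_add] at h
  have h₀ : (0 : ℝ) < c ^ n := by positivity
  calc ∫⁻ z, F (c • z) ∂cubeVol n
      = ENNReal.ofReal ((c ^ n)⁻¹) * ∫⁻ x in cube 0 c, F x := by
        rw [h, ← mul_assoc, ← ENNReal.ofReal_mul (by positivity), inv_mul_cancel₀ h₀.ne',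
          ENNReal.ofReal_one, one_mul]
    _ ≤ _ := by
        gcongr
        exact Measure.restrict_mono (cube_mono 0 hc₁) le_rfl

end Cubes

/-! ### Polynomials -/

section Polynomials

variable {n k : ℕ}

lemma mem_polys_iff {P : MvPolynomial (Fin n) ℝ} :
    P ∈ polys n (k + 1) ↔ P ∈ MvPolynomial.restrictTotalDegree (Fin n) ℝ k := by
  rw [MvPolynomial.mem_restrictTotalDegree, polys, mem_ofPred_eq, Nat.lt_succ_iff]
  constructor
  · rintro (rfl | h)
    · simp
    · exact h
  · exact Or.inr

lemma zero_mem_polys : (0 : MvPolynomial (Fin n) ℝ) ∈ polys n k := Or.inl rfl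

lemma continuous_eval_poly (P : MvPolynomial (Fin n) ℝ) :
    Continuous fun z : EuclideanSpace ℝ (Fin n) => MvPolynomial.eval (fun i => z i) P :=
  (MvPolynomial.continuous_eval P).comp (by fun_prop)

lemma measurable_eval_poly (P : MvPolynomial (Fin n) ℝ) :
    Measurable fun z : EuclideanSpace ℝ (Fin n) => MvPolynomial.eval (fun i => z i) P :=
  (continuous_eval_poly P).measurable

/-- An affine change of variables maps polynomials of degree at most `k - 1` to polynomials of
degree at most `k - 1`. -/
lemma exists_affine_mem_polys {P : MvPolynomial (Fin n) ℝ} (hP : P ∈ polys n k)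
    (y : EuclideanSpace ℝ (Fin n)) (r : ℝ) :
    ∃ P' ∈ polys n k, ∀ z : EuclideanSpace ℝ (Fin n),
      MvPolynomial.eval (fun i => z i) P' = MvPolynomial.eval (fun i => (y + r • z) i) P := by
  obtain _ | k := k
  · obtain rfl | h := hP
    · exact ⟨0, zero_mem_polys, by simp⟩
    · simp at h
  let L : Fin n → MvPolynomial (Fin n) ℝ :=
    fun i => MvPolynomial.C (y i) + MvPolynomial.C r * MvPolynomial.X i
  have hL : ∀ i, (L i).totalDegree ≤ 1 := by
    intro i
    refine (MvPolynomial.totalDegree_add _ _).trans (max_le (by simp) ?_)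
    refine (MvPolynomial.totalDegree_mul _ _).trans ?_
    simp
  refine ⟨MvPolynomial.aeval L P, ?_, fun z => ?_⟩
  · rw [mem_polys_iff, MvPolynomial.mem_restrictTotalDegree] at *
    rw [MvPolynomial.aeval_def, MvPolynomial.eval₂_eq]
    refine MvPolynomial.totalDegree_finsetSum_le fun s hs => ?_
    refine (MvPolynomial.totalDegree_mul _ _).trans ?_
    rw [MvPolynomial.algebraMap_eq, MvPolynomial.totalDegree_C, zero_add]
    refine (MvPolynomial.totalDegree_finsetProd _ _).trans ?_
    refine le_trans ?_ ((MvPolynomial.le_totalDegree hs).trans hP)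
    refine Finset.sum_le_sum fun i _ => ?_
    refine (MvPolynomial.totalDegree_pow _ _).trans ?_
    exact (Nat.mul_le_mul_left _ (hL i)).trans (by simp)
  · rw [← MvPolynomial.coe_aeval_eq_eval, ← MvPolynomial.coe_aeval_eq_eval]
    simp only [RingHom.coe_coe]
    rw [← AlgHom.comp_apply, MvPolynomial.comp_aeval]
    congr 2
    ext i
    simp [L]

/-- On the polynomials of degree at most `k`, the form `(P, R) ↦ ∫_Q P R`, with `Q = Q(0, 1)`, is
positive definite, so each coefficient functional is integration against a polynomial. -/
lemma exists_coeff_kernel (k : ℕ) (β : Fin n →₀ ℕ) :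
    ∃ φ : EuclideanSpace ℝ (Fin n) → ℝ, Continuous φ ∧ ∀ P ∈ polys n k,
      ∫ z, φ z * MvPolynomial.eval (fun i => z i) P ∂cubeVol n = MvPolynomial.coeff β P := by
  obtain _ | k := k
  · refine ⟨0, continuous_zero, fun P hP => ?_⟩
    obtain rfl | h := hP
    · simp
    · simp at h
  let V := MvPolynomial.restrictTotalDegree (Fin n) ℝ k
  have hint : ∀ φ : EuclideanSpace ℝ (Fin n) → ℝ, Continuous φ → Integrable φ (cubeVol n) :=
    fun φ hφ => hφ.continuousOn.integrableOn_compact (isCompact_cube 0 1)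
  let ev : MvPolynomial (Fin n) ℝ → EuclideanSpace ℝ (Fin n) → ℝ :=
    fun P z => MvPolynomial.eval (fun i => z i) P
  have hev : ∀ P, Continuous (ev P) := continuous_eval_poly
  have hmul : ∀ P R, Integrable (fun z => ev P z * ev R z) (cubeVol n) :=
    fun P R => hint _ ((hev P).mul (hev R))
  let B : LinearMap.BilinForm ℝ V := LinearMap.mk₂ ℝ
    (fun P R => ∫ z, ev P z * ev R z ∂cubeVol n)
    (fun P P' R => by
      rw [← integral_add (hmul _ _) (hmul _ _)]
      simp [ev, add_mul])
    (fun c P R => by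
      rw [smul_eq_mul, ← integral_const_mul]
      simp [ev, mul_assoc])
    (fun P R R' => by
      rw [← integral_add (hmul _ _) (hmul _ _)]
      simp [ev, mul_add])
    (fun c P R => by
      rw [smul_eq_mul, ← integral_const_mul]
      simp [ev, mul_left_comm])
  have hB : ∀ P : V, B P P = 0 → P = 0 := by
    intro P hP
    have h₁ : (fun z => ev P z * ev P z) =ᵐ[cubeVol n] 0 :=
      (integral_eq_zero_iff_of_nonneg (fun z => mul_self_nonneg _)
        (hmul P P)).1 hP
    -- A continuous function vanishing a.e. on the open unit ball, which lies in the cube,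
    -- vanishes there identically.
    have h₂ : ∀ z ∈ Metric.ball (0 : EuclideanSpace ℝ (Fin n)) 1, ev P z * ev P z = 0 := by
      have h₃ : (fun z => ev P z * ev P z) =ᵐ[volume.restrict (Metric.ball 0 1)] 0 :=
        ae_mono (Measure.restrict_mono
          (Metric.ball_subset_closedBall.trans (closedBall_subset_cube 0 1)) le_rfl) h₁
      exact Measure.eqOn_open_of_ae_eq h₃ Metric.isOpen_ball
        ((hev P).mul (hev P)).continuousOn continuousOn_const
    have h₄ : (P : MvPolynomial (Fin n) ℝ) = 0 := by
      -- The box `(0, 1 / (n + 1))ⁿ` lies in the Euclidean unit ball.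
      have hpos : (0 : ℝ) < 1 / (n + 1) := by positivity
      refine MvPolynomial.funext_set (fun _ => Ioo 0 (1 / (n + 1 : ℝ)))
        (fun _ => Ioo_infinite hpos) fun x hx => ?_
      have h₅ : WithLp.toLp 2 x ∈ Metric.ball (0 : EuclideanSpace ℝ (Fin n)) 1 := by
        rw [mem_ball_zero_iff, EuclideanSpace.norm_eq, Real.sqrt_lt' one_pos]
        have : ∀ i, ‖x i‖ ^ 2 ≤ 1 / (n + 1 : ℝ) := by
          intro i
          have hi := hx i (mem_univ i)
          have h1 : (1 : ℝ) / (n + 1) ≤ 1 := by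
            rw [div_le_one (by positivity)]; linarith [(Nat.cast_nonneg n : (0 : ℝ) ≤ n)]
          rw [Real.norm_eq_abs, sq_abs]
          nlinarith [hi.1, hi.2]
        calc ∑ i, ‖x i‖ ^ 2 ≤ ∑ _i : Fin n, 1 / (n + 1 : ℝ) := Finset.sum_le_sum fun i _ => this i
          _ = n / (n + 1 : ℝ) := by simp [div_eq_mul_inv]
          _ < 1 ^ 2 := by rw [one_pow, div_lt_one (by positivity)]; linarith
      have h₆ := h₂ _ h₅
      rw [mul_self_eq_zero] at h₆
      simpa [ev] using h₆
    exact Subtype.ext h₄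
  have hnd : B.Nondegenerate := by
    constructor
    · intro P hP
      exact hB P (hP P)
    · intro P hP
      exact hB P (hP P)
  let ℓ : Module.Dual ℝ V := (MvPolynomial.lcoeff ℝ β).comp V.subtype
  refine ⟨ev ((B.toDual hnd).symm ℓ), hev _, fun P hP => ?_⟩
  exact LinearMap.BilinForm.apply_toDual_symm_apply (hB := hnd) ℓ ⟨P, mem_polys_iff.1 hP⟩

end Polynomials

/-! ### Best approximation on the reference cube and coefficient functionals -/

/-- The power mean inequality for normalized integrals over a set. -/
lemma laverage_rpow_le {α : Type*} [MeasurableSpace α] {μ : Measure α} {A : Set α}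
    (hA₀ : μ A ≠ 0) (hA : μ A ≠ ∞) {F : α → ℝ≥0∞} (hF : Measurable F) {u p : ℝ} (hu : 0 < u)
    (hup : u ≤ p) :
    ((μ A)⁻¹ * ∫⁻ x in A, F x ^ u ∂μ) ^ (1 / u) ≤ ((μ A)⁻¹ * ∫⁻ x in A, F x ^ p ∂μ) ^ (1 / p) := by
  have hprob : IsProbabilityMeasure ((μ A)⁻¹ • μ.restrict A) :=
    ⟨by simpa using ENNReal.inv_mul_cancel hA₀ hA⟩
  have h := eLpNorm'_le_eLpNorm'_of_exponent_le hu hup ((μ A)⁻¹ • μ.restrict A)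
    hF.aestronglyMeasurable
  simpa [eLpNorm', lintegral_smul_measure] using h

/-- The best approximation of `g` by polynomials of degree at most `k - 1` in `L¹(Q(0, 1))`. -/
noncomputable def polyErr {n : ℕ} (k : ℕ) (g : EuclideanSpace ℝ (Fin n) → ℝ) : ℝ≥0∞ :=
  ⨅ P ∈ polys n k, ∫⁻ z, ‖g z - MvPolynomial.eval (fun i => z i) P‖ₑ ∂cubeVol n

section PolyErr

variable {n k : ℕ}

lemma lintegral_rescaled_le {f : EuclideanSpace ℝ (Fin n) → ℝ} (hf : Measurable f) {u : ℝ}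
    (hu : 1 ≤ u) (y : EuclideanSpace ℝ (Fin n)) {r : ℝ} (hr : 0 < r) :
    ∫⁻ z, ‖f (y + r • z)‖ₑ ∂cubeVol n ≤ cubeVol n univ *
      ((volume (cube y r))⁻¹ * ∫⁻ x in cube y r, ‖f x‖ₑ ^ u) ^ (1 / u) := by
  have hV := (cubeVol_univ_pos (n := n)).ne'
  have hV' := measure_ne_top (cubeVol n) univ
  have hA₀ : volume (cube y r) ≠ 0 := by
    rw [volume_cube y hr]
    exact mul_ne_zero (by simpa using pow_pos hr n) hV
  have h := laverage_rpow_le hA₀ (isCompact_cube y r).measure_lt_top.ne hf.enorm one_pos hu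
  simp only [ENNReal.rpow_one, div_one] at h
  rw [inv_volume_mul_lintegral_cube y hr hf.enorm] at h
  rwa [← ENNReal.inv_mul_le_iff hV hV']

lemma polyErr_le_localApprox {f : EuclideanSpace ℝ (Fin n) → ℝ} (hf : Measurable f) {u : ℝ}
    (hu : 1 ≤ u) (y : EuclideanSpace ℝ (Fin n)) {r : ℝ} (hr : 0 < r) :
    polyErr k (fun z => f (y + r • z)) ≤
      cubeVol n univ * localApprox volume k u f (cube y r) := by
  have hV := (cubeVol_univ_pos (n := n)).ne'
  have hV' := measure_ne_top (cubeVol n) univ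
  rw [← ENNReal.inv_mul_le_iff hV hV']
  refine le_iInf₂ fun P hP => ?_
  rw [ENNReal.inv_mul_le_iff hV hV']
  obtain ⟨P', hP', h⟩ := exists_affine_mem_polys hP y r
  refine (iInf₂_le P' hP').trans ?_
  simp_rw [h]
  exact lintegral_rescaled_le (f := fun x => f x - MvPolynomial.eval (fun i => x i) P)
    (hf.sub (measurable_eval_poly P)) hu y hr

lemma integrable_eval_poly (P : MvPolynomial (Fin n) ℝ) :
    Integrable (fun z : EuclideanSpace ℝ (Fin n) => MvPolynomial.eval (fun i => z i) P)
      (cubeVol n) :=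
  (continuous_eval_poly P).continuousOn.integrableOn_compact (isCompact_cube 0 1)

lemma le_of_forall_mem_polys {g : EuclideanSpace ℝ (Fin n) → ℝ} (hg : Integrable g (cubeVol n))
    {X C : ℝ} (hC : 0 < C)
    (h : ∀ P ∈ polys n k, X ≤ C * ∫ z, |g z - MvPolynomial.eval (fun i => z i) P| ∂cubeVol n) :
    X ≤ C * (polyErr k g).toReal := by
  have hi : ∀ P : MvPolynomial (Fin n) ℝ,
      Integrable (fun z => g z - MvPolynomial.eval (fun i => z i) P) (cubeVol n) :=
    fun P => hg.sub (integrable_eval_poly P)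
  have hfin : polyErr k g ≠ ∞ :=
    ((iInf₂_le 0 zero_mem_polys).trans_lt (hi 0).hasFiniteIntegral).ne
  rw [← div_le_iff₀' hC]
  refine (ENNReal.ofReal_le_iff_le_toReal hfin).1 (le_iInf₂ fun P hP => ?_)
  rw [← ofReal_integral_norm_eq_lintegral_enorm (hi P)]
  refine ENNReal.ofReal_le_ofReal ?_
  rw [div_le_iff₀' hC]
  exact h P hP

lemma integrable_comp_smul {c : ℝ} (hc : 0 < c) (hc₁ : c ≤ 1)
    {h : EuclideanSpace ℝ (Fin n) → ℝ} (hm : Measurable h) (hi : Integrable h (cubeVol n)) :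
    Integrable (fun z => h (c • z)) (cubeVol n) := by
  refine ⟨(hm.comp (measurable_const_smul c)).aestronglyMeasurable, ?_⟩
  exact (lintegral_comp_smul_le hc hc₁ hm.enorm).trans_lt
    (ENNReal.mul_lt_top ENNReal.ofReal_lt_top hi.hasFiniteIntegral)

lemma integral_abs_comp_smul_le {c : ℝ} (hc : 0 < c) (hc₁ : c ≤ 1)
    {h : EuclideanSpace ℝ (Fin n) → ℝ} (hm : Measurable h) (hi : Integrable h (cubeVol n)) :
    ∫ z, |h (c • z)| ∂cubeVol n ≤ (c ^ n)⁻¹ * ∫ z, |h z| ∂cubeVol n := by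
  have h₁ := lintegral_comp_smul_le hc hc₁ hm.enorm
  have h₀ : 0 ≤ ∫ z, |h z| ∂cubeVol n := integral_nonneg fun z => abs_nonneg _
  rw [← ofReal_integral_norm_eq_lintegral_enorm hi,
    ← ofReal_integral_norm_eq_lintegral_enorm (integrable_comp_smul hc hc₁ hm hi),
    ← ENNReal.ofReal_mul (by positivity)] at h₁
  exact (ENNReal.ofReal_le_ofReal_iff (mul_nonneg (by positivity) h₀)).1 h₁

lemma exists_dilation_mem_polys {P : MvPolynomial (Fin n) ℝ} (hP : P ∈ polys n k) (c : ℝ) :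
    ∃ P' ∈ polys n k, (∀ z : EuclideanSpace ℝ (Fin n),
      MvPolynomial.eval (fun i => z i) P' = MvPolynomial.eval (fun i => (c • z) i) P) ∧
      ∀ β, MvPolynomial.coeff β P' = c ^ β.degree * MvPolynomial.coeff β P := by
  refine ⟨∑ s ∈ P.support, MvPolynomial.monomial s (c ^ s.degree * MvPolynomial.coeff s P),
    ?_, fun z => ?_, fun β => ?_⟩
  · obtain _ | k := k
    · obtain rfl | h := hP
      · simp [zero_mem_polys]
      · simp at h
    rw [mem_polys_iff, MvPolynomial.mem_restrictTotalDegree] at *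
    refine MvPolynomial.totalDegree_finsetSum_le fun s hs => ?_
    exact (MvPolynomial.totalDegree_monomial_le _ _).trans
      ((MvPolynomial.le_totalDegree hs).trans hP)
  · rw [map_sum, MvPolynomial.eval_eq']
    refine Finset.sum_congr rfl fun s _ => ?_
    rw [MvPolynomial.eval_monomial, Finsupp.prod_fintype _ _ (by simp)]
    simp only [PiLp.smul_apply, smul_eq_mul, mul_pow, Finset.prod_mul_distrib,
      Finset.prod_pow_eq_pow_sum, Finsupp.degree_eq_sum]
    ring
  · classical
    simp only [MvPolynomial.coeff_sum, MvPolynomial.coeff_monomial, Finset.sum_ite_eq',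
      MvPolynomial.mem_support_iff]
    split_ifs with h
    · rfl
    · rw [not_not.1 h, mul_zero]

/-- The functional of a kernel reproducing the coefficient of order `β` maps `g(c ·)` to
`c ^ |β|` times the coefficient of a polynomial `P`, up to the `L¹` distance from `g` to `P`. -/
lemma abs_kernel_sub_coeff_le {φ : EuclideanSpace ℝ (Fin n) → ℝ} {β : Fin n →₀ ℕ} {M : ℝ}
    (hφ : Continuous φ) (hM : ∀ z ∈ cube 0 1, |φ z| ≤ M)
    (hrep : ∀ P ∈ polys n k,
      ∫ z, φ z * MvPolynomial.eval (fun i => z i) P ∂cubeVol n = MvPolynomial.coeff β P)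
    {g : EuclideanSpace ℝ (Fin n) → ℝ} (hm : Measurable g) (hg : Integrable g (cubeVol n))
    {P : MvPolynomial (Fin n) ℝ} (hP : P ∈ polys n k) {c : ℝ} (hc : 0 < c) (hc₁ : c ≤ 1) :
    |∫ z, φ z * g (c • z) ∂cubeVol n - c ^ β.degree * MvPolynomial.coeff β P| ≤
      M * ((c ^ n)⁻¹ * ∫ z, |g z - MvPolynomial.eval (fun i => z i) P| ∂cubeVol n) := by
  obtain ⟨P', hP', he, hco⟩ := exists_dilation_mem_polys hP c
  have hM₀ : 0 ≤ M := (abs_nonneg _).trans (hM 0 (mem_cube_self 0 zero_le_one))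
  have hMae : ∀ᵐ z ∂cubeVol n, ‖φ z‖ ≤ M :=
    (ae_restrict_iff' (measurableSet_cube 0 1)).2 (Eventually.of_forall hM)
  have hgc := integrable_comp_smul hc hc₁ hm hg
  have hdm : Measurable fun z => g z - MvPolynomial.eval (fun i => z i) P :=
    hm.sub (measurable_eval_poly P)
  have hdi := hg.sub (integrable_eval_poly P)
  have hdc := integrable_comp_smul hc hc₁ hdm hdi
  rw [← hco, ← hrep P' hP', ← integral_sub (hgc.bdd_mul hφ.aestronglyMeasurable hMae)
    ((integrable_eval_poly P').bdd_mul hφ.aestronglyMeasurable hMae)]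
  calc |∫ z, (φ z * g (c • z) - φ z * MvPolynomial.eval (fun i => z i) P') ∂cubeVol n|
      ≤ ∫ z, M * |g (c • z) - MvPolynomial.eval (fun i => (c • z) i) P| ∂cubeVol n := by
        rw [← Real.norm_eq_abs]
        refine norm_integral_le_of_norm_le (hdc.abs.const_mul M) ?_
        filter_upwards [hMae] with z hz
        rw [he, ← mul_sub, norm_mul, Real.norm_eq_abs (_ - _)]
        gcongr
    _ = M * ∫ z, |g (c • z) - MvPolynomial.eval (fun i => (c • z) i) P| ∂cubeVol n :=
        integral_const_mul _ _
    _ ≤ _ := by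
        gcongr
        exact integral_abs_comp_smul_le hc hc₁ hdm hdi

end PolyErr

/-- The multi-indices of order less than `k`. -/
noncomputable def multiIndices (n k : ℕ) : Finset (Fin n →₀ ℕ) :=
  (Finsupp.finite_of_degree_lt k).toFinset

/-- A finite family of continuous kernels on `Q(0, 1)` reproducing the coefficients of the
polynomials of degree at most `k - 1`, with a common bound `M`. -/
structure CoeffKernels (n k : ℕ) where
  /-- The kernel that reproduces the coefficient of order `β`. -/
  φ : (Fin n →₀ ℕ) → EuclideanSpace ℝ (Fin n) → ℝ
  /-- A bound for the kernels of order less than `k`. -/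
  M : ℝ
  continuous_φ : ∀ β, Continuous (φ β)
  rep : ∀ β, ∀ P ∈ polys n k,
    ∫ z, φ β z * MvPolynomial.eval (fun i => z i) P ∂cubeVol n = MvPolynomial.coeff β P
  M_pos : 0 < M
  bound : ∀ β ∈ insert 0 (multiIndices n k), ∀ z ∈ cube 0 1, |φ β z| ≤ M

section Kernels

variable {n k : ℕ}

lemma nonempty_coeffKernels (n k : ℕ) : Nonempty (CoeffKernels n k) := by
  choose φ hφ hrep using fun β : Fin n →₀ ℕ => exists_coeff_kernel (n := n) k β
  have hb : ∀ β, ∃ B : ℝ, ∀ z ∈ cube (0 : EuclideanSpace ℝ (Fin n)) 1, |φ β z| ≤ B := fun β =>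
    (isCompact_cube 0 1).exists_bound_of_continuousOn (hφ β).continuousOn
  choose B hB using hb
  have hB₀ : ∀ β, 0 ≤ B β := fun β =>
    (abs_nonneg _).trans (hB β 0 (mem_cube_self 0 zero_le_one))
  refine ⟨⟨φ, 1 + ∑ β ∈ insert 0 (multiIndices n k), B β, hφ, hrep, ?_, fun β hβ z hz => ?_⟩⟩
  · have := Finset.sum_nonneg fun β (_ : β ∈ insert 0 (multiIndices n k)) => hB₀ β
    linarith
  · have := Finset.single_le_sum (fun γ _ => hB₀ γ) hβ
    linarith [hB β z hz]

/-- The functional `g ↦ ∫_Q φ_β g`, `Q = Q(0, 1)`, that extends the coefficient of order `β` from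
polynomials to integrable functions. -/
noncomputable def CoeffKernels.coef (K : CoeffKernels n k) (β : Fin n →₀ ℕ)
    (g : EuclideanSpace ℝ (Fin n) → ℝ) : ℝ :=
  ∫ z, K.φ β z * g z ∂cubeVol n

/-- The sum of the absolute values of the coefficients of positive order; it controls how far the
projection of `g` onto polynomials is from a constant. -/
noncomputable def CoeffKernels.osc (K : CoeffKernels n k)
    (g : EuclideanSpace ℝ (Fin n) → ℝ) : ℝ :=
  ∑ β ∈ (multiIndices n k).erase 0, |K.coef β g|

variable (K : CoeffKernels n k) {g : EuclideanSpace ℝ (Fin n) → ℝ}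

lemma CoeffKernels.abs_coef_sub_coeff_le {β : Fin n →₀ ℕ} (hβ : β ∈ insert 0 (multiIndices n k))
    (hm : Measurable g) (hg : Integrable g (cubeVol n))
    {P : MvPolynomial (Fin n) ℝ} (hP : P ∈ polys n k) :
    |K.coef β g - MvPolynomial.coeff β P| ≤
      K.M * ∫ z, |g z - MvPolynomial.eval (fun i => z i) P| ∂cubeVol n := by
  simpa [CoeffKernels.coef] using
    abs_kernel_sub_coeff_le (K.continuous_φ β) (K.bound β hβ) (K.rep β) hm hg hP one_pos le_rfl

/-- Passing from `g` to `g(· / 2)` multiplies the coefficient of order `β` by `2 ^ (-|β|)`, up to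
the best approximation of `g`. -/
lemma CoeffKernels.abs_coef_half_sub_le {β : Fin n →₀ ℕ}
    (hβ : β ∈ insert 0 (multiIndices n k)) (hm : Measurable g) (hg : Integrable g (cubeVol n)) :
    |K.coef β (fun z => g ((1 / 2 : ℝ) • z)) - (1 / 2) ^ β.degree * K.coef β g| ≤
      (K.M * (2 ^ n + 1)) * (polyErr k g).toReal := by
  refine le_of_forall_mem_polys hg (mul_pos K.M_pos (by positivity)) fun P hP => ?_
  have h₁ := abs_kernel_sub_coeff_le (K.continuous_φ β) (K.bound β hβ) (K.rep β) hm hg hP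
    (c := 1 / 2) (by norm_num) (by norm_num)
  have h₂ := K.abs_coef_sub_coeff_le hβ hm hg hP
  set δ := ∫ z, |g z - MvPolynomial.eval (fun i => z i) P| ∂cubeVol n
  have h₃ : |(1 / 2 : ℝ) ^ β.degree * (MvPolynomial.coeff β P - K.coef β g)| ≤ K.M * δ := by
    rw [abs_mul, abs_sub_comm, abs_of_nonneg (by positivity)]
    refine (mul_le_of_le_one_left (abs_nonneg _) ?_).trans h₂
    exact pow_le_one₀ (by norm_num) (by norm_num)
  have h₄ : ((1 / 2 : ℝ) ^ n)⁻¹ = 2 ^ n := by simp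
  rw [h₄] at h₁
  calc _ = |(∫ z, K.φ β z * g ((1 / 2 : ℝ) • z) ∂cubeVol n
          - (1 / 2) ^ β.degree * MvPolynomial.coeff β P)
        + (1 / 2 : ℝ) ^ β.degree * (MvPolynomial.coeff β P - K.coef β g)| := by
        rw [CoeffKernels.coef]; congr 1; ring
    _ ≤ K.M * (2 ^ n * δ) + K.M * δ := (abs_add_le _ _).trans (add_le_add h₁ h₃)
    _ = _ := by ring

lemma CoeffKernels.osc_half_le (hm : Measurable g) (hg : Integrable g (cubeVol n)) :
    K.osc (fun z => g ((1 / 2 : ℝ) • z)) ≤ 1 / 2 * K.osc g +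
      ((multiIndices n k).card * (K.M * (2 ^ n + 1))) * (polyErr k g).toReal := by
  rw [CoeffKernels.osc, CoeffKernels.osc, Finset.mul_sum, mul_assoc, ← nsmul_eq_mul]
  have hε : 0 ≤ (K.M * (2 ^ n + 1)) * (polyErr k g).toReal :=
    mul_nonneg (mul_nonneg K.M_pos.le (by positivity)) ENNReal.toReal_nonneg
  refine le_trans ?_ (add_le_add_right
    (nsmul_le_nsmul_left hε (Finset.card_erase_le (a := 0) (s := multiIndices n k))) _)
  rw [← Finset.sum_const, ← Finset.sum_add_distrib]
  refine Finset.sum_le_sum fun β hβ => ?_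
  obtain ⟨hβ₀, hβ⟩ := Finset.mem_erase.1 hβ
  have h := K.abs_coef_half_sub_le (Finset.mem_insert_of_mem hβ) hm hg
  have hd : (1 / 2 : ℝ) ^ β.degree ≤ 1 / 2 := by
    refine pow_le_of_le_one (by norm_num) (by norm_num) ?_
    rwa [Ne, Finsupp.degree_eq_zero_iff]
  have h₂ : |(1 / 2 : ℝ) ^ β.degree * K.coef β g| ≤ 1 / 2 * |K.coef β g| := by
    rw [abs_mul, abs_of_nonneg (by positivity)]
    gcongr
  have h₃ := abs_sub_abs_le_abs_sub (K.coef β (fun z => g ((1 / 2 : ℝ) • z)))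
    ((1 / 2) ^ β.degree * K.coef β g)
  linarith

/-- On `Q(0, 1)` a polynomial differs from its constant term by at most the sum of its other
coefficients. -/
lemma abs_eval_sub_coeff_zero_le {P : MvPolynomial (Fin n) ℝ} (hP : P ∈ polys n k)
    {z : EuclideanSpace ℝ (Fin n)} (hz : z ∈ cube 0 1) :
    |MvPolynomial.eval (fun i => z i) P - MvPolynomial.coeff 0 P| ≤
      ∑ β ∈ (multiIndices n k).erase 0, |MvPolynomial.coeff β P| := by
  classical
  have hsub : P.support ⊆ insert 0 (multiIndices n k) := by
    intro s hs
    refine Finset.mem_insert_of_mem ?_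
    rw [multiIndices, Finite.mem_toFinset, mem_ofPred_eq]
    obtain rfl | h := hP
    · simp at hs
    · exact (MvPolynomial.le_totalDegree hs).trans_lt h
  rw [MvPolynomial.eval_eq', Finset.sum_subset hsub,
    ← Finset.add_sum_erase _ _ (Finset.mem_insert_self 0 _), Finset.erase_insert_eq_erase]
  · simp only [Finsupp.coe_zero, Pi.zero_apply, pow_zero, Finset.prod_const_one, mul_one,
      add_sub_cancel_left]
    refine (Finset.abs_sum_le_sum_abs _ _).trans (Finset.sum_le_sum fun β _ => ?_)
    rw [abs_mul, Finset.abs_prod]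
    refine mul_le_of_le_one_right (abs_nonneg _) (Finset.prod_le_one (fun _ _ => abs_nonneg _) ?_)
    intro i _
    rw [abs_pow]
    exact pow_le_one₀ (abs_nonneg _) (by simpa using hz i)
  · intro s _ hs
    rw [MvPolynomial.notMem_support_iff.1 hs, zero_mul]

/-- Averages over concentric cubes of comparable size are close to the constant term. -/
lemma CoeffKernels.abs_average_sub_coef_le (hm : Measurable g) (hg : Integrable g (cubeVol n))
    {c : ℝ} (hc : 1 / 2 ≤ c) (hc₁ : c ≤ 1) :
    |⨍ z, g (c • z) ∂cubeVol n - K.coef 0 g| ≤ K.osc g +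
      (((cubeVol n).real univ)⁻¹ * 2 ^ n + ((multiIndices n k).card + 1) * K.M) *
        (polyErr k g).toReal := by
  have hc₀ : 0 < c := by linarith
  have hV : 0 < (cubeVol n).real univ :=
    ENNReal.toReal_pos cubeVol_univ_pos.ne' (measure_ne_top _ _)
  rw [← sub_le_iff_le_add']
  refine le_of_forall_mem_polys hg ?_ fun P hP => ?_
  · have := K.M_pos
    positivity
  set δ := ∫ z, |g z - MvPolynomial.eval (fun i => z i) P| ∂cubeVol n with hδ
  have hδ₀ : 0 ≤ δ := integral_nonneg fun z => abs_nonneg _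
  have hdm : Measurable fun z => g z - MvPolynomial.eval (fun i => z i) P :=
    hm.sub (measurable_eval_poly P)
  have hdi := hg.sub (integrable_eval_poly P)
  have hpc := integrable_comp_smul hc₀ hc₁ (measurable_eval_poly P) (integrable_eval_poly P)
  have h₁ : |⨍ z, g (c • z) ∂cubeVol n
      - ⨍ z, MvPolynomial.eval (fun i => (c • z) i) P ∂cubeVol n| ≤
      ((cubeVol n).real univ)⁻¹ * 2 ^ n * δ := by
    rw [average_eq, average_eq, ← smul_sub, ← integral_sub (integrable_comp_smul hc₀ hc₁ hm hg) hpc,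
      smul_eq_mul, abs_mul, abs_of_pos (inv_pos.2 hV), mul_assoc]
    gcongr
    refine (abs_integral_le_integral_abs).trans
      ((integral_abs_comp_smul_le hc₀ hc₁ hdm hdi).trans ?_)
    gcongr
    rw [← inv_pow]
    refine pow_le_pow_left₀ (by positivity) ?_ n
    rw [inv_le_comm₀ hc₀ two_pos]
    linarith
  have h₂ : |⨍ z, MvPolynomial.eval (fun i => (c • z) i) P ∂cubeVol n - MvPolynomial.coeff 0 P| ≤
      ∑ β ∈ (multiIndices n k).erase 0, |MvPolynomial.coeff β P| := by
    have h₃ : ⨍ z, MvPolynomial.eval (fun i => (c • z) i) P ∂cubeVol n - MvPolynomial.coeff 0 P =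
        ((cubeVol n).real univ)⁻¹ *
          ∫ z, (MvPolynomial.eval (fun i => (c • z) i) P - MvPolynomial.coeff 0 P) ∂cubeVol n := by
      rw [integral_sub hpc (integrable_const _), average_eq, integral_const]
      simp only [smul_eq_mul]
      field_simp
    rw [h₃, abs_mul, abs_of_pos (inv_pos.2 hV), inv_mul_le_iff₀ hV, mul_comm]
    rw [← Real.norm_eq_abs]
    refine norm_integral_le_of_norm_le_const ?_
    refine (ae_restrict_iff' (measurableSet_cube 0 1)).2 (Eventually.of_forall fun z hz => ?_)
    refine abs_eval_sub_coeff_zero_le hP fun i => ?_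
    have := hz i
    simp only [PiLp.zero_apply, sub_zero, PiLp.smul_apply, smul_eq_mul, abs_mul,
      abs_of_pos hc₀] at this ⊢
    exact mul_le_one₀ hc₁ (abs_nonneg _) this
  have h₄ : ∑ β ∈ (multiIndices n k).erase 0, |MvPolynomial.coeff β P| ≤
      K.osc g + (multiIndices n k).card * (K.M * δ) := by
    rw [CoeffKernels.osc, ← nsmul_eq_mul]
    refine le_trans ?_ (add_le_add_right (nsmul_le_nsmul_left (mul_nonneg K.M_pos.le hδ₀)
      (Finset.card_erase_le (a := 0) (s := multiIndices n k))) _)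
    rw [← Finset.sum_const, ← Finset.sum_add_distrib]
    refine Finset.sum_le_sum fun β hβ => ?_
    have h := K.abs_coef_sub_coeff_le
      (Finset.mem_insert_of_mem (Finset.mem_of_mem_erase hβ)) hm hg hP
    have h' := abs_sub_abs_le_abs_sub (MvPolynomial.coeff β P) (K.coef β g)
    rw [abs_sub_comm] at h'
    linarith
  have h₅ := K.abs_coef_sub_coeff_le (Finset.mem_insert_self 0 _) hm hg hP
  rw [abs_sub_comm] at h₅
  have h₆ := abs_sub_le (⨍ z, g (c • z) ∂cubeVol n)
    (⨍ z, MvPolynomial.eval (fun i => (c • z) i) P ∂cubeVol n) (K.coef 0 g)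
  have h₇ := abs_sub_le (⨍ z, MvPolynomial.eval (fun i => (c • z) i) P ∂cubeVol n)
    (MvPolynomial.coeff 0 P) (K.coef 0 g)
  linarith

end Kernels

/-! ### The trace at a point -/

lemma HasTraceAt.trace_eq {n : ℕ} {f : EuclideanSpace ℝ (Fin n) → ℝ} {x : EuclideanSpace ℝ (Fin n)}
    {l : ℝ} (h : HasTraceAt f x l) : trace f x = l := by
  have h' : ∃ l, HasTraceAt f x l := ⟨l, h⟩
  rw [trace, dif_pos h']
  exact tendsto_nhds_unique h'.choose_spec h

lemma summable_of_le_half_mul_add {b ε : ℕ → ℝ} (hb : ∀ j, 0 ≤ b j) (hε : ∀ j, 0 ≤ ε j)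
    (hs : Summable ε) (h : ∀ j, b (j + 1) ≤ 1 / 2 * b j + ε j) : Summable b := by
  refine summable_of_sum_range_le (c := 2 * (b 0 + ∑' j, ε j)) hb fun N => ?_
  induction N with
  | zero =>
    have : 0 ≤ ∑' j, ε j := tsum_nonneg hε
    have := hb 0
    simp only [Finset.range_zero, Finset.sum_empty]
    positivity
  | succ N ih =>
    rw [Finset.sum_range_succ']
    have h₁ : ∑ j ∈ Finset.range N, b (j + 1) ≤
        1 / 2 * ∑ j ∈ Finset.range N, b j + ∑ j ∈ Finset.range N, ε j := by
      rw [Finset.mul_sum, ← Finset.sum_add_distrib]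
      exact Finset.sum_le_sum fun j _ => h j
    have h₂ := hs.sum_le_tsum (Finset.range N) fun j _ => hε j
    linarith

section TraceAt

variable {n k : ℕ} (K : CoeffKernels n k)

/-- The value at `y` of the projection of `f` onto polynomials at scale `2 ^ (-j)` around `y`. -/
noncomputable def CoeffKernels.approx (f : EuclideanSpace ℝ (Fin n) → ℝ) (j : ℕ)
    (y : EuclideanSpace ℝ (Fin n)) : ℝ :=
  K.coef 0 (fun z => f (y + (1 / 2 : ℝ) ^ j • z))

/-- The rate constant for the convergence of `CoeffKernels.approx`. -/
noncomputable def CoeffKernels.rate : ℝ := K.M * (2 ^ n + 1)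

lemma CoeffKernels.rate_pos : 0 < K.rate := mul_pos K.M_pos (by positivity)

variable {f : EuclideanSpace ℝ (Fin n) → ℝ} {y : EuclideanSpace ℝ (Fin n)}

/-- If the best approximations of `f` at the scales `2 ^ (-j)` around `y` are summable, then the
projections of `f` at these scales converge at `y`, their oscillation decays, and so the averages
of `f` converge to the same limit. -/
lemma CoeffKernels.exists_hasTraceAt (hf : Measurable f)
    (hi : ∀ j : ℕ, Integrable (fun z => f (y + (1 / 2 : ℝ) ^ j • z)) (cubeVol n))
    (hs : ∑' j : ℕ, polyErr k (fun z => f (y + (1 / 2 : ℝ) ^ j • z)) ≠ ∞) :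
    ∃ l, HasTraceAt f y l ∧ Tendsto (fun j => K.approx f j y) atTop (𝓝 l) ∧
      ∀ i, ‖l - K.approx f i y‖ₑ ≤ ENNReal.ofReal K.rate *
        ∑' j : ℕ, polyErr k (fun z => f (y + (1 / 2 : ℝ) ^ (i + j) • z)) := by
  set g : ℕ → EuclideanSpace ℝ (Fin n) → ℝ := fun j z => f (y + (1 / 2 : ℝ) ^ j • z) with hg
  have hm : ∀ j, Measurable (g j) := fun j => hf.comp (by fun_prop)
  have hsucc : ∀ j, g (j + 1) = fun z => g j ((1 / 2 : ℝ) • z) := by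
    intro j
    ext z
    simp only [hg, smul_smul, pow_succ]
  set ε : ℕ → ℝ := fun j => (polyErr k (g j)).toReal with hε
  have hε₀ : ∀ j, 0 ≤ ε j := fun j => ENNReal.toReal_nonneg
  have hεs : Summable ε := ENNReal.summable_toReal hs
  have hfin : ∀ j, polyErr k (g j) ≠ ∞ := ENNReal.ne_top_of_tsum_ne_top hs
  have hR := K.rate_pos
  have hstep : ∀ j, dist (K.approx f j y) (K.approx f j.succ y) ≤ K.rate * ε j := by
    intro j
    have h := K.abs_coef_half_sub_le (Finset.mem_insert_self 0 _) (hm j) (hi j)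
    rw [← hsucc, map_zero, pow_zero, one_mul] at h
    rw [dist_comm]
    exact h
  have hRs : Summable fun j => K.rate * ε j := hεs.mul_left _
  obtain ⟨l, hl⟩ := cauchySeq_tendsto_of_complete (cauchySeq_of_dist_le_of_summable _ hstep hRs)
  have hosc : Tendsto (fun j => K.osc (g j)) atTop (𝓝 0) := by
    refine (summable_of_le_half_mul_add (fun j => Finset.sum_nonneg fun _ _ => abs_nonneg _)
      (fun j => ?_) (hεs.mul_left ((multiIndices n k).card * K.rate))
      fun j => ?_).tendsto_atTop_zero
    · exact mul_nonneg (by positivity) (hε₀ j)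
    · rw [hsucc]
      exact K.osc_half_le (hm j) (hi j)
  refine ⟨l, ?_, hl, fun i => ?_⟩
  · set A : ℝ := ((cubeVol n).real univ)⁻¹ * 2 ^ n + ((multiIndices n k).card + 1) * K.M
    have hsum : Tendsto (fun j => K.osc (g j) + A * ε j + |K.approx f j y - l|) atTop (𝓝 0) := by
      have h₁ := hεs.tendsto_atTop_zero.const_mul A
      have h₂ := (hl.sub_const l).abs
      simpa using (hosc.add h₁).add h₂
    rw [HasTraceAt, Metric.tendsto_nhds]
    intro δ hδ
    obtain ⟨N, hN⟩ := eventually_atTop.1 (hsum.eventually_lt_const hδ)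
    have hr₀ : (0 : ℝ) < (1 / 2) ^ N := by positivity
    filter_upwards [Ioo_mem_nhdsGT hr₀] with r hr
    obtain ⟨j, hj₁, hj₂⟩ := exists_nat_pow_near_of_lt_one (y := (1 / 2 : ℝ)) hr.1
      (hr.2.le.trans (pow_le_one₀ (by norm_num) (by norm_num))) (by norm_num) (by norm_num)
    have hj : N ≤ j := by
      by_contra! hlt
      have := pow_le_pow_of_le_one (a := (1 / 2 : ℝ)) (by norm_num) (by norm_num)
        (Nat.succ_le_of_lt hlt)
      exact absurd (hj₁.trans hr.2) (not_lt.2 this)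
    have hp : (0 : ℝ) < (1 / 2) ^ j := by positivity
    -- The cube of radius `r` is the dilate by `r / 2 ^ (-j) ∈ [1/2, 1]` of the dyadic one.
    have havg := K.abs_average_sub_coef_le (hm j) (hi j) (c := r / (1 / 2) ^ j)
      (by rw [le_div_iff₀ hp]; rw [pow_succ] at hj₁; linarith) (by rwa [div_le_one hp])
    have hcomp : ∀ z, g j ((r / (1 / 2) ^ j) • z) = f (y + r • z) := by
      intro z
      simp only [hg, smul_smul]
      rw [mul_div_cancel₀ _ hp.ne']
    simp_rw [hcomp] at havg
    rw [setAverage_cube y hr.1, Real.dist_eq]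
    refine lt_of_le_of_lt ?_ (hN j hj)
    exact (abs_sub_le _ (K.approx f j y) _).trans (add_le_add_left havg _)
  · have h := dist_le_tsum_of_dist_le_of_tendsto _ hstep hRs hl i
    rw [Real.enorm_eq_ofReal_abs, ← Real.dist_eq, dist_comm]
    refine (ENNReal.ofReal_le_ofReal h).trans ?_
    rw [tsum_mul_left, ENNReal.ofReal_mul hR.le, ENNReal.ofReal_tsum_of_nonneg (fun j => hε₀ _)
      ((summable_nat_add_iff i).2 hεs |>.congr fun j => by rw [add_comm])]
    gcongr with j
    exact ENNReal.ofReal_toReal_le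

/-- The approximation of `f` at `y` differs from the value of a polynomial `P` at `y` by at most
the mean distance from `f` to `P` near `y`. -/
lemma CoeffKernels.enorm_approx_sub_eval_le (hf : Measurable f) (j : ℕ)
    (hi : Integrable (fun z => f (y + (1 / 2 : ℝ) ^ j • z)) (cubeVol n))
    {P : MvPolynomial (Fin n) ℝ} (hP : P ∈ polys n k) :
    ‖K.approx f j y - MvPolynomial.eval (fun i => y i) P‖ₑ ≤ ENNReal.ofReal K.M *
      ∫⁻ z, ‖f (y + (1 / 2 : ℝ) ^ j • z) -
        MvPolynomial.eval (fun i => (y + (1 / 2 : ℝ) ^ j • z) i) P‖ₑ ∂cubeVol n := by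
  obtain ⟨P', hP', h⟩ := exists_affine_mem_polys hP y ((1 / 2 : ℝ) ^ j)
  have h₀ : MvPolynomial.coeff 0 P' = MvPolynomial.eval (fun i => y i) P := by
    have := h 0
    simp only [smul_zero, add_zero] at this
    rw [← this, ← MvPolynomial.constantCoeff_eq]
    exact (RingHom.congr_fun MvPolynomial.eval_zero P').symm
  have h₁ := K.abs_coef_sub_coeff_le (Finset.mem_insert_self 0 _)
    (hf.comp (by fun_prop : Measurable fun z => y + (1 / 2 : ℝ) ^ j • z)) hi hP'
  rw [h₀] at h₁
  have h₂ := ofReal_integral_norm_eq_lintegral_enorm (hi.sub (integrable_eval_poly P'))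
  simp only [Pi.sub_apply] at h₂
  simp_rw [← h]
  rw [← h₂, ← ENNReal.ofReal_mul K.M_pos.le, Real.enorm_eq_ofReal_abs]
  exact ENNReal.ofReal_le_ofReal h₁

lemma CoeffKernels.measurable_approx (hf : Measurable f) (j : ℕ) : Measurable (K.approx f j) := by
  have h : Measurable fun w : EuclideanSpace ℝ (Fin n) × EuclideanSpace ℝ (Fin n) =>
      K.φ 0 w.2 * f (w.1 + (1 / 2 : ℝ) ^ j • w.2) :=
    ((K.continuous_φ 0).measurable.comp measurable_snd).mul (hf.comp (by fun_prop))
  exact (h.stronglyMeasurable.integral_prod_right (ν := cubeVol n)).measurable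

end TraceAt

/-! ### Minkowski's inequality for series and a discrete Hardy inequality -/

/-- Minkowski's inequality for a series of nonnegative functions. -/
lemma lintegral_Lp_tsum_le {α : Type*} [MeasurableSpace α] {μ : Measure α} {p : ℝ} (hp : 1 ≤ p)
    {F : ℕ → α → ℝ≥0∞} (hF : ∀ j, Measurable (F j)) :
    (∫⁻ x, (∑' j, F j x) ^ p ∂μ) ^ (1 / p) ≤ ∑' j, (∫⁻ x, F j x ^ p ∂μ) ^ (1 / p) := by
  have hp₀ : 0 < p := one_pos.trans_le hp
  have hfin : ∀ N, (∫⁻ x, (∑ j ∈ Finset.range N, F j x) ^ p ∂μ) ^ (1 / p) ≤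
      ∑ j ∈ Finset.range N, (∫⁻ x, F j x ^ p ∂μ) ^ (1 / p) := by
    intro N
    induction N with
    | zero => simp [hp₀]
    | succ N ih =>
      simp_rw [Finset.sum_range_succ]
      refine (ENNReal.lintegral_Lp_add_le (f := fun x => ∑ j ∈ Finset.range N, F j x) (g := F N)
        (Finset.measurable_fun_sum _ fun j _ => hF j).aemeasurable (hF N).aemeasurable hp).trans ?_
      exact add_le_add_left ih _
  rw [one_div, ENNReal.rpow_inv_le_iff hp₀]
  have hsup : ∀ x, (∑' j, F j x) ^ p = ⨆ N, (∑ j ∈ Finset.range N, F j x) ^ p := fun x => by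
    rw [ENNReal.tsum_eq_iSup_nat]
    exact (ENNReal.orderIsoRpow p hp₀).map_iSup _
  simp_rw [hsup]
  rw [lintegral_iSup
    (fun N => (Finset.measurable_fun_sum _ fun j _ => hF j).pow_const p)]
  · refine iSup_le fun N => ?_
    rw [← ENNReal.rpow_inv_le_iff hp₀, ← one_div]
    exact (hfin N).trans (by simpa [one_div] using ENNReal.sum_le_tsum (Finset.range N))
  · intro N N' h x
    exact ENNReal.rpow_le_rpow (Finset.sum_le_sum_of_subset (Finset.range_mono h)) hp₀.le

/-- Hardy's inequality in discrete form: convolution with a summable sequence is bounded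
on `ℓ^q`. -/
lemma tsum_rpow_tsum_shift_le {q : ℝ} (hq : 1 ≤ q) (c a : ℕ → ℝ≥0∞) :
    (∑' i, (∑' m, c m * a (i + m)) ^ q) ^ (1 / q) ≤ (∑' m, c m) * (∑' j, a j ^ q) ^ (1 / q) := by
  have hq₀ : 0 < q := one_pos.trans_le hq
  have h := lintegral_Lp_tsum_le (μ := Measure.count) hq (F := fun m i => c m * a (i + m))
    (fun m => measurable_of_countable _)
  simp only [lintegral_count] at h
  refine h.trans ?_
  rw [← ENNReal.tsum_mul_right]
  gcongr with m
  simp_rw [ENNReal.mul_rpow_of_nonneg _ _ hq₀.le]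
  rw [ENNReal.tsum_mul_left, ENNReal.mul_rpow_of_nonneg _ _ (by positivity), ← ENNReal.rpow_mul,
    mul_one_div_cancel hq₀.ne', ENNReal.rpow_one]
  exact mul_le_mul_right (ENNReal.rpow_le_rpow
    (ENNReal.tsum_comp_le_tsum_of_injective (add_left_injective m) fun j => a j ^ q)
    (by positivity)) _

/-! ### Averages over cubes with respect to two measures -/

section Averages

variable {n : ℕ}

/-- Averages over cubes of fixed size, integrated, by Tonelli's theorem. -/
lemma lintegral_lintegral_cube (μ ν : Measure (EuclideanSpace ℝ (Fin n))) [SFinite μ] [SFinite ν]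
    {F : EuclideanSpace ℝ (Fin n) → ℝ≥0∞} (hF : Measurable F) (r : ℝ) :
    ∫⁻ y, ∫⁻ z in cube y r, F z ∂ν ∂μ = ∫⁻ z, F z * μ (cube z r) ∂ν := by
  have hmeas : Measurable (Function.uncurry fun y z : EuclideanSpace ℝ (Fin n) =>
      (cube y r).indicator F z) := by
    have : (Function.uncurry fun y z : EuclideanSpace ℝ (Fin n) => (cube y r).indicator F z) =
        {w : EuclideanSpace ℝ (Fin n) × EuclideanSpace ℝ (Fin n) | w.2 ∈ cube w.1 r}.indicator
          (fun w => F w.2) := by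
      ext w
      simp [Function.uncurry, indicator]
    rw [this]
    exact (hF.comp measurable_snd).indicator (isClosed_setOf_mem_cube r).measurableSet
  simp_rw [← lintegral_indicator (measurableSet_cube _ r)]
  rw [lintegral_lintegral_swap hmeas.aemeasurable]
  refine lintegral_congr fun z => ?_
  have : ∀ y, (cube y r).indicator F z = (cube z r).indicator (fun _ => F z) y := by
    intro y
    by_cases h : z ∈ cube y r
    · rw [indicator_of_mem h, indicator_of_mem (mem_cube_comm.1 h)]
    · rw [indicator_of_notMem h, indicator_of_notMem (mt mem_cube_comm.1 h)]
  simp_rw [this]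
  rw [lintegral_indicator (measurableSet_cube z r), setLIntegral_const]

lemma measurable_lintegral_cube (ν : Measure (EuclideanSpace ℝ (Fin n))) [SFinite ν]
    {F : EuclideanSpace ℝ (Fin n) → ℝ≥0∞} (hF : Measurable F) (r : ℝ) :
    Measurable fun y => ∫⁻ z in cube y r, F z ∂ν := by
  simp_rw [← lintegral_indicator (measurableSet_cube _ r)]
  refine Measurable.lintegral_prod_right'
    (f := {w : EuclideanSpace ℝ (Fin n) × EuclideanSpace ℝ (Fin n) | w.2 ∈ cube w.1 r}.indicator
      fun w => F w.2) ?_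
  exact (hF.comp measurable_snd).indicator (isClosed_setOf_mem_cube r).measurableSet

lemma upperSemicontinuous_measure_cube {ν : Measure (EuclideanSpace ℝ (Fin n))}
    (hν : ∀ y r, ν (cube y r) ≠ ∞) (r : ℝ) : UpperSemicontinuous fun y => ν (cube y r) := by
  intro y c hc
  have hlim : Tendsto (fun m : ℕ => ν (cube y (r + 1 / ((m : ℝ) + 1)))) atTop
      (𝓝 (ν (cube y r))) := by
    have hcap : cube y r = ⋂ m : ℕ, cube y (r + 1 / ((m : ℝ) + 1)) := by
      ext z
      simp only [mem_iInter]
      refine ⟨fun hz m => cube_mono y (by simp; positivity) hz, fun hz i => ?_⟩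
      have h₁ : Tendsto (fun m : ℕ => r + 1 / ((m : ℝ) + 1)) atTop (𝓝 (r + 0)) :=
        tendsto_one_div_add_atTop_nhds_zero_nat.const_add r
      rw [add_zero] at h₁
      exact ge_of_tendsto' h₁ fun m => hz m i
    rw [hcap]
    refine tendsto_measure_iInter_atTop (fun m => (measurableSet_cube _ _).nullMeasurableSet)
      (fun m m' h => cube_mono y ?_) ⟨0, hν _ _⟩
    have : (m : ℝ) ≤ m' := by exact_mod_cast h
    gcongr
  obtain ⟨m, hm⟩ := (hlim.eventually_lt_const hc).exists
  filter_upwards [cube_mem_nhds y (r := 1 / ((m : ℝ) + 1)) (by positivity)] with y' hy'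
  exact (measure_mono (cube_subset_cube hy' (by linarith))).trans_lt hm

end Averages

/-! ### Dependence of the local approximation on the cube -/

section LocalApprox

lemma localApprox_congr_ae {n k : ℕ} {u : ℝ} {μ : Measure (EuclideanSpace ℝ (Fin n))}
    {f g : EuclideanSpace ℝ (Fin n) → ℝ} (h : f =ᵐ[μ] g) (A : Set (EuclideanSpace ℝ (Fin n))) :
    localApprox μ k u f A = localApprox μ k u g A := by
  have : ∀ P : MvPolynomial (Fin n) ℝ,
      ∫⁻ y in A, ‖f y - MvPolynomial.eval (fun i => y i) P‖ₑ ^ u ∂μ =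
        ∫⁻ y in A, ‖g y - MvPolynomial.eval (fun i => y i) P‖ₑ ^ u ∂μ := fun P =>
    lintegral_congr_ae <| by
      filter_upwards [ae_restrict_of_ae h] with y hy
      rw [hy]
  simp only [localApprox, this]

variable {n k : ℕ} {f : EuclideanSpace ℝ (Fin n) → ℝ} {u : ℝ}

lemma localApprox_le_two_pow_mul (hu : 1 ≤ u) {y z : EuclideanSpace ℝ (Fin n)} {r s : ℝ}
    (hr : 0 < r) (hs : 0 < s) (hsr : s ≤ 2 * r) (h : cube y r ⊆ cube z s) :
    localApprox volume k u f (cube y r) ≤ 2 ^ n * localApprox volume k u f (cube z s) := by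
  have hu₀ : 0 < u := one_pos.trans_le hu
  have h2 : (2 : ℝ≥0∞) ^ n ≠ 0 := by simp
  have h2' : (2 : ℝ≥0∞) ^ n ≠ ∞ := by finiteness
  have hV := (cubeVol_univ_pos (n := n)).ne'
  have hV' := measure_ne_top (cubeVol n) univ
  have hvol : (volume (cube y r))⁻¹ ≤ 2 ^ n * (volume (cube z s))⁻¹ := by
    have hle : volume (cube z s) ≤ 2 ^ n * volume (cube y r) := by
      rw [volume_cube y hr, volume_cube z hs, ← mul_assoc]
      gcongr
      have : (2 : ℝ≥0∞) ^ n = ENNReal.ofReal (2 ^ n) := by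
        rw [ENNReal.ofReal_pow two_pos.le, ENNReal.ofReal_ofNat]
      rw [this, ← ENNReal.ofReal_mul (by positivity), ← mul_pow]
      exact ENNReal.ofReal_le_ofReal (pow_le_pow_left₀ hs.le hsr n)
    rw [← ENNReal.inv_le_inv, ENNReal.mul_inv (Or.inl h2) (Or.inl h2')] at hle
    rwa [ENNReal.inv_mul_le_iff h2 h2'] at hle
  rw [← ENNReal.inv_mul_le_iff h2 h2']
  refine le_iInf₂ fun P hP => ?_
  rw [ENNReal.inv_mul_le_iff h2 h2']
  refine (iInf₂_le P hP).trans ?_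
  calc _ ≤ (2 ^ n * ((volume (cube z s))⁻¹ *
        ∫⁻ x in cube z s, ‖f x - MvPolynomial.eval (fun i => x i) P‖ₑ ^ u)) ^ (1 / u) := by
        rw [← mul_assoc]
        gcongr
    _ = ((2 : ℝ≥0∞) ^ n) ^ (1 / u) * ((volume (cube z s))⁻¹ *
        ∫⁻ x in cube z s, ‖f x - MvPolynomial.eval (fun i => x i) P‖ₑ ^ u) ^ (1 / u) :=
        ENNReal.mul_rpow_of_nonneg _ _ (by positivity)
    _ ≤ _ := by
        gcongr
        calc ((2 : ℝ≥0∞) ^ n) ^ (1 / u) ≤ ((2 : ℝ≥0∞) ^ n) ^ (1 : ℝ) :=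
              ENNReal.rpow_le_rpow_of_exponent_le (one_le_pow₀ one_le_two)
                ((div_le_one hu₀).2 hu)
          _ = 2 ^ n := ENNReal.rpow_one _

lemma measurable_localApprox (hf : Measurable f) (hu : 1 ≤ u)
    (hfu : ∀ y r, MemLp f (ENNReal.ofReal u) (volume.restrict (cube y r))) {r : ℝ} (hr : 0 < r) :
    Measurable fun y => localApprox volume k u f (cube y r) := by
  have hu₀ : 0 < u := one_pos.trans_le hu
  refine UpperSemicontinuous.measurable (upperSemicontinuous_biInf fun P _ => ?_)
  set h : EuclideanSpace ℝ (Fin n) → ℝ := fun x => f x - MvPolynomial.eval (fun i => x i) P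
  have hm : Measurable h := hf.sub (measurable_eval_poly P)
  have hc : (volume (cube (0 : EuclideanSpace ℝ (Fin n)) r))⁻¹ ≠ ∞ := by
    rw [Ne, ENNReal.inv_eq_top, volume_cube _ hr, mul_eq_zero, not_or]
    exact ⟨by simpa using pow_pos hr n, cubeVol_univ_pos.ne'⟩
  have heq : (fun y => ((volume (cube y r))⁻¹ * ∫⁻ x in cube y r, ‖h x‖ₑ ^ u) ^ (1 / u)) =
      (fun t => ((volume (cube (0 : EuclideanSpace ℝ (Fin n)) r))⁻¹ * t) ^ (1 / u)) ∘
        fun y => (volume.withDensity fun x => ‖h x‖ₑ ^ u) (cube y r) := by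
    ext y
    simp only [Function.comp_apply, withDensity_apply _ (measurableSet_cube y r),
      volume_cube _ hr]
  rw [heq]
  refine Continuous.comp_upperSemicontinuous ?_
    (upperSemicontinuous_measure_cube (fun y s => ?_) r) ?_
  · exact (ENNReal.continuous_rpow_const).comp (ENNReal.continuous_const_mul hc)
  · rw [withDensity_apply _ (measurableSet_cube y s)]
    have hfin : IsFiniteMeasure (volume.restrict (cube y s)) :=
      ⟨by simpa using (isCompact_cube y s).measure_lt_top⟩
    obtain ⟨B, hB⟩ := (isCompact_cube y s).exists_bound_of_continuousOn
      (continuous_eval_poly P).continuousOn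
    have hP : MemLp (fun x : EuclideanSpace ℝ (Fin n) => MvPolynomial.eval (fun i => x i) P)
        (ENNReal.ofReal u) (volume.restrict (cube y s)) :=
      MemLp.of_bound (measurable_eval_poly P).aestronglyMeasurable B
        ((ae_restrict_iff' (measurableSet_cube y s)).2 (Eventually.of_forall hB))
    have := lintegral_rpow_enorm_lt_top_of_eLpNorm_lt_top (by simpa using hu₀)
      ENNReal.ofReal_ne_top ((hfu y s).sub hP).2
    rw [ENNReal.toReal_ofReal hu₀.le] at this
    exact this.ne
  · intro s t hst
    exact ENNReal.rpow_le_rpow (mul_le_mul_right hst _) (by positivity)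

/-- Taking `P = 0` bounds the local approximation by a mean of `f`. -/
lemma localApprox_le_mean {μ : Measure (EuclideanSpace ℝ (Fin n))}
    {A : Set (EuclideanSpace ℝ (Fin n))} (hA₀ : μ A ≠ 0) (hA : μ A ≠ ∞) (hf : Measurable f)
    {p : ℝ} (hu : 1 ≤ u) (hup : u ≤ p) :
    localApprox μ k u f A ≤ ((μ A)⁻¹ * ∫⁻ x in A, ‖f x‖ₑ ^ p ∂μ) ^ (1 / p) := by
  refine (iInf₂_le 0 zero_mem_polys).trans ?_
  simp only [map_zero, sub_zero]
  exact laverage_rpow_le hA₀ hA hf.enorm (one_pos.trans_le hu) hup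

end LocalApprox

/-! ### Measures on `d`-sets -/

/-- The quantitative properties of the natural measure `μ` on a `d`-set `S` that the trace
estimates use. The last one bounds the measure of cubes with arbitrary centre. -/
structure RegularOn {n : ℕ} (μ : Measure (EuclideanSpace ℝ (Fin n)))
    (S : Set (EuclideanSpace ℝ (Fin n))) (d c₁ c₂ : ℝ) : Prop where
  pos₁ : 0 < c₁
  pos₂ : 0 < c₂
  ae_mem : ∀ᵐ x ∂μ, x ∈ S
  lower : ∀ w ∈ S, ∀ r : ℝ, 0 < r → r ≤ 1 → ENNReal.ofReal (c₁ * r ^ d) ≤ μ (cube w r)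
  upper : ∀ w ∈ S, ∀ r : ℝ, 0 < r → r ≤ 1 → μ (cube w r) ≤ ENNReal.ofReal (c₂ * r ^ d)
  upper_all : ∀ z, ∀ r : ℝ, 0 < r → r ≤ 1 / 2 → μ (cube z r) ≤ ENNReal.ofReal (c₂ * (2 * r) ^ d)

lemma setMeasure_cube {n : ℕ} (d : ℝ) (S : Set (EuclideanSpace ℝ (Fin n)))
    (x : EuclideanSpace ℝ (Fin n)) (r : ℝ) :
    setMeasure d S (cube x r) = Measure.hausdorffMeasure d (cube x r ∩ S) :=
  Measure.restrict_apply (measurableSet_cube x r)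

lemma IsDSet.exists_regularOn {n : ℕ} {d : ℝ} {S : Set (EuclideanSpace ℝ (Fin n))}
    (hS : IsDSet d S) : ∃ c₁ c₂ : ℝ, RegularOn (setMeasure d S) S d c₁ c₂ := by
  obtain ⟨-, -, hcl, c₁, c₂, h₁, h₂, h⟩ := hS
  refine ⟨c₁, c₂, h₁, h₂, ae_restrict_mem hcl.measurableSet, ?_, ?_, fun z r hr hr' => ?_⟩
  · exact fun w hw r hr hr' => (setMeasure_cube d S w r).symm ▸ (h w hw r hr hr').1
  · exact fun w hw r hr hr' => (setMeasure_cube d S w r).symm ▸ (h w hw r hr hr').2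
  · rw [setMeasure_cube]
    obtain hempty | ⟨w, hw, hwS⟩ := (cube z r ∩ S).eq_empty_or_nonempty
    · simp [hempty]
    · refine le_trans (measure_mono ?_) (h w hwS (2 * r) (by linarith) (by linarith)).2
      exact inter_subset_inter_left _ (cube_subset_cube (mem_cube_comm.1 hw) (by linarith))

lemma IsDSet.sigmaFinite {n : ℕ} {d : ℝ} {S : Set (EuclideanSpace ℝ (Fin n))}
    (hS : IsDSet d S) : SigmaFinite (setMeasure d S) := by
  obtain ⟨c₁, c₂, h⟩ := hS.exists_regularOn
  have : IsLocallyFiniteMeasure (setMeasure d S) :=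
    ⟨fun x => ⟨cube x (1 / 2), cube_mem_nhds x (by norm_num),
      (h.upper_all x _ (by norm_num) le_rfl).trans_lt ENNReal.ofReal_lt_top⟩⟩
  infer_instance

section Regular

variable {n : ℕ} {μ : Measure (EuclideanSpace ℝ (Fin n))}
  {S : Set (EuclideanSpace ℝ (Fin n))} {d c₁ c₂ : ℝ}

lemma RegularOn.measure_cube_ne_zero (h : RegularOn μ S d c₁ c₂) {x : EuclideanSpace ℝ (Fin n)}
    (hx : x ∈ S) {r : ℝ} (hr : 0 < r) (hr₁ : r ≤ 1) : μ (cube x r) ≠ 0 := by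
  refine ((ENNReal.ofReal_pos.2 ?_).trans_le (h.lower x hx r hr hr₁)).ne'
  have := h.pos₁
  positivity

lemma RegularOn.measure_cube_ne_top (h : RegularOn μ S d c₁ c₂) {x : EuclideanSpace ℝ (Fin n)}
    (hx : x ∈ S) {r : ℝ} (hr : 0 < r) (hr₁ : r ≤ 1) : μ (cube x r) ≠ ∞ :=
  ((h.upper x hx r hr hr₁).trans_lt ENNReal.ofReal_lt_top).ne

/-- Lebesgue means over cubes of radius `r` centred on `S`: the loss is `r ^ (d - n)`. -/
lemma RegularOn.lintegral_volume_mean_le [SFinite μ] (h : RegularOn μ S d c₁ c₂)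
    {F : EuclideanSpace ℝ (Fin n) → ℝ≥0∞} (hF : Measurable F) {r : ℝ} (hr : 0 < r)
    (hr₁ : r ≤ 1 / 2) :
    ∫⁻ y, ((volume (cube y r))⁻¹ * ∫⁻ z in cube y r, F z) ∂μ ≤
      ENNReal.ofReal (c₂ * 2 ^ d) * (cubeVol n univ)⁻¹ * ENNReal.ofReal (r ^ (d - n)) *
        ∫⁻ z, F z := by
  have h₀ : ENNReal.ofReal (r ^ n) ≠ 0 := by simpa using pow_pos hr n
  simp_rw [volume_cube _ hr]
  rw [lintegral_const_mul _ (measurable_lintegral_cube volume hF r),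
    lintegral_lintegral_cube μ volume hF r]
  calc (ENNReal.ofReal (r ^ n) * cubeVol n univ)⁻¹ * ∫⁻ z, F z * μ (cube z r)
      ≤ (ENNReal.ofReal (r ^ n) * cubeVol n univ)⁻¹ *
          ∫⁻ z, F z * ENNReal.ofReal (c₂ * (2 * r) ^ d) := by
        gcongr with z
        exact h.upper_all z r hr hr₁
    _ = _ := by
        have hc₂ := h.pos₂
        rw [lintegral_mul_const _ hF, ENNReal.mul_inv (Or.inl h₀) (Or.inl ENNReal.ofReal_ne_top),
          ← ENNReal.ofReal_inv_of_pos (pow_pos hr n)]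
        have : ENNReal.ofReal ((r ^ n)⁻¹) * ENNReal.ofReal (c₂ * (2 * r) ^ d) =
            ENNReal.ofReal (c₂ * 2 ^ d) * ENNReal.ofReal (r ^ (d - n)) := by
          rw [← ENNReal.ofReal_mul (by positivity), ← ENNReal.ofReal_mul (by positivity),
            Real.mul_rpow two_pos.le hr.le, Real.rpow_sub hr, Real.rpow_natCast]
          congr 1
          field_simp
        calc _ = (ENNReal.ofReal ((r ^ n)⁻¹) * ENNReal.ofReal (c₂ * (2 * r) ^ d)) *
              (cubeVol n univ)⁻¹ * ∫⁻ z, F z := by ring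
          _ = _ := by rw [this]; ring

/-- Means with respect to `μ` over cubes centred on `S`. -/
lemma RegularOn.lintegral_mean_le [SFinite μ] (h : RegularOn μ S d c₁ c₂)
    {F : EuclideanSpace ℝ (Fin n) → ℝ≥0∞} (hF : Measurable F) {r : ℝ} (hr : 0 < r)
    (hr₁ : r ≤ 1) :
    ∫⁻ x, (μ (cube x r))⁻¹ * ∫⁻ y in cube x r, F y ∂μ ∂μ ≤
      ENNReal.ofReal (c₂ / c₁) * ∫⁻ y, F y ∂μ := by
  have hc₁ := h.pos₁
  have hc₂ := h.pos₂
  have hp : 0 < c₁ * r ^ d := by positivity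
  calc ∫⁻ x, (μ (cube x r))⁻¹ * ∫⁻ y in cube x r, F y ∂μ ∂μ
      ≤ ∫⁻ x, (ENNReal.ofReal (c₁ * r ^ d))⁻¹ * ∫⁻ y in cube x r, F y ∂μ ∂μ := by
        refine lintegral_mono_ae ?_
        filter_upwards [h.ae_mem] with x hx
        gcongr
        exact h.lower x hx r hr hr₁
    _ = (ENNReal.ofReal (c₁ * r ^ d))⁻¹ * ∫⁻ y, F y * μ (cube y r) ∂μ := by
        rw [lintegral_const_mul _ (measurable_lintegral_cube μ hF r),
          lintegral_lintegral_cube μ μ hF r]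
    _ ≤ (ENNReal.ofReal (c₁ * r ^ d))⁻¹ * ∫⁻ y, F y * ENNReal.ofReal (c₂ * r ^ d) ∂μ := by
        gcongr 1
        refine lintegral_mono_ae ?_
        filter_upwards [h.ae_mem] with x hx
        gcongr
        exact h.upper x hx r hr hr₁
    _ = _ := by
        rw [lintegral_mul_const _ hF, mul_comm (∫⁻ y, F y ∂μ), ← mul_assoc,
          ← ENNReal.ofReal_inv_of_pos hp, ← ENNReal.ofReal_mul (by positivity)]
        congr 2
        field_simp

end Regular

/-! ### Estimates for the trace in terms of the local approximations on `S` -/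

section Estimates

variable {n k : ℕ} {μ : Measure (EuclideanSpace ℝ (Fin n))}
  {S : Set (EuclideanSpace ℝ (Fin n))} {d c₁ c₂ u p : ℝ} {f : EuclideanSpace ℝ (Fin n) → ℝ}

/-- The local approximation in `L^u(ℝⁿ)` at the dyadic scale `2 ^ (-j)`. -/
noncomputable def dyadicErr (k : ℕ) (u : ℝ) (f : EuclideanSpace ℝ (Fin n) → ℝ) (j : ℕ)
    (y : EuclideanSpace ℝ (Fin n)) : ℝ≥0∞ :=
  localApprox volume k u f (cube y ((1 / 2) ^ j))

/-- The `L^p(μ)` norm of `dyadicErr`. -/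
noncomputable def dyadicNorm (μ : Measure (EuclideanSpace ℝ (Fin n))) (k : ℕ) (u p : ℝ)
    (f : EuclideanSpace ℝ (Fin n) → ℝ) (j : ℕ) : ℝ≥0∞ :=
  (∫⁻ y, dyadicErr k u f j y ^ p ∂μ) ^ (1 / p)

lemma half_pow_pos (j : ℕ) : (0 : ℝ) < (1 / 2) ^ j := by positivity

lemma half_pow_le_one (j : ℕ) : (1 / 2 : ℝ) ^ j ≤ 1 := pow_le_one₀ (by norm_num) (by norm_num)

lemma memLp_restrict_cube (hfp : MemLp f (ENNReal.ofReal p) volume) (hup : u ≤ p)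
    (y : EuclideanSpace ℝ (Fin n)) (r : ℝ) :
    MemLp f (ENNReal.ofReal u) (volume.restrict (cube y r)) := by
  have : IsFiniteMeasure (volume.restrict (cube y r)) :=
    ⟨by simpa using (isCompact_cube y r).measure_lt_top⟩
  exact (hfp.restrict _).mono_exponent (ENNReal.ofReal_le_ofReal hup)

lemma integrable_rescaled (hf : Measurable f) (hfp : MemLp f (ENNReal.ofReal p) volume)
    (hp : 1 ≤ p) (y : EuclideanSpace ℝ (Fin n)) {r : ℝ} (hr : 0 < r) :
    Integrable (fun z => f (y + r • z)) (cubeVol n) := by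
  have h₁ := memLp_restrict_cube hfp hp y r
  rw [ENNReal.ofReal_one, memLp_one_iff_integrable] at h₁
  have h₂ := h₁.hasFiniteIntegral
  refine ⟨(hf.comp (by fun_prop)).aestronglyMeasurable, ?_⟩
  rw [hasFiniteIntegral_iff_enorm, lintegral_cube y hr hf.enorm] at h₂
  by_contra h₃
  rw [hasFiniteIntegral_iff_enorm, not_lt, top_le_iff] at h₃
  rw [h₃, ENNReal.mul_top (by simpa using pow_pos hr n)] at h₂
  exact lt_irrefl _ h₂

lemma measurable_dyadicErr (hf : Measurable f) (hfp : MemLp f (ENNReal.ofReal p) volume)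
    (hu : 1 ≤ u) (hup : u ≤ p) (j : ℕ) : Measurable (dyadicErr k u f j) :=
  measurable_localApprox hf hu (memLp_restrict_cube hfp hup) (half_pow_pos j)

/-- The local approximations on `S` at one scale, against those on `ℝⁿ` at twice that scale. -/
lemma RegularOn.dyadicNorm_succ_le [SFinite μ] (h : RegularOn μ S d c₁ c₂) (hf : Measurable f)
    (hfp : MemLp f (ENNReal.ofReal p) volume) (hu : 1 ≤ u) (hup : u ≤ p) (j : ℕ) :
    dyadicNorm μ k u p f (j + 1) ≤
      2 ^ n * (ENNReal.ofReal (c₂ * 2 ^ d) * (cubeVol n univ)⁻¹) ^ (1 / p) *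
        ENNReal.ofReal (2 ^ (((j : ℝ) + 1) * ((n - d) / p))) * dyadicNorm volume k u p f j := by
  have hp₀ : 0 < p := by linarith
  set r : ℝ := (1 / 2) ^ (j + 1) with hr
  have hr₀ : 0 < r := half_pow_pos _
  have hr₁ : r ≤ 1 / 2 := by
    rw [hr, pow_succ]; linarith [half_pow_le_one j]
  have h2r : (1 / 2 : ℝ) ^ j = 2 * r := by rw [hr, pow_succ]; ring
  have hm := measurable_dyadicErr (k := k) hf hfp hu hup j
  have hpt : ∀ y, dyadicErr k u f (j + 1) y ^ p ≤
      (volume (cube y r))⁻¹ * ∫⁻ z in cube y r, (2 ^ n * dyadicErr k u f j z) ^ p := by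
    intro y
    have hv₀ : volume (cube y r) ≠ 0 := by
      rw [volume_cube y hr₀]
      exact mul_ne_zero (by simpa using pow_pos hr₀ n) cubeVol_univ_pos.ne'
    rw [mul_comm, ← div_eq_mul_inv, ENNReal.le_div_iff_mul_le (Or.inl hv₀)
      (Or.inl (isCompact_cube y r).measure_lt_top.ne), ← setLIntegral_const]
    refine setLIntegral_mono' (measurableSet_cube y r) fun z hz => ?_
    gcongr
    refine localApprox_le_two_pow_mul hu hr₀ (half_pow_pos j) h2r.le ?_
    exact cube_subset_cube (mem_cube_comm.1 hz) (by linarith)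
  have hint : ∫⁻ y, dyadicErr k u f (j + 1) y ^ p ∂μ ≤
      ENNReal.ofReal (c₂ * 2 ^ d) * (cubeVol n univ)⁻¹ * ENNReal.ofReal (r ^ (d - n)) *
        ((2 ^ n) ^ p * ∫⁻ z, dyadicErr k u f j z ^ p) := by
    refine (lintegral_mono hpt).trans
      ((h.lintegral_volume_mean_le ((hm.const_mul _).pow_const p) hr₀ hr₁).trans_eq ?_)
    simp_rw [ENNReal.mul_rpow_of_nonneg _ _ hp₀.le]
    rw [lintegral_const_mul _ (hm.pow_const p)]
  have hrp : ENNReal.ofReal (r ^ (d - n)) ^ (1 / p) =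
      ENNReal.ofReal (2 ^ (((j : ℝ) + 1) * ((n - d) / p))) := by
    rw [ENNReal.ofReal_rpow_of_pos (by positivity), ← Real.rpow_mul hr₀.le]
    congr 1
    rw [hr, one_div, inv_pow, ← Real.rpow_natCast, ← Real.rpow_neg two_pos.le,
      ← Real.rpow_mul two_pos.le]
    congr 1
    push_cast
    field_simp
    ring
  calc dyadicNorm μ k u p f (j + 1)
      ≤ (ENNReal.ofReal (c₂ * 2 ^ d) * (cubeVol n univ)⁻¹ * ENNReal.ofReal (r ^ (d - n)) *
        ((2 ^ n) ^ p * ∫⁻ z, dyadicErr k u f j z ^ p)) ^ (1 / p) := by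
        rw [dyadicNorm]; gcongr
    _ = _ := by
        have hp' : 0 ≤ 1 / p := by positivity
        rw [ENNReal.mul_rpow_of_nonneg _ _ hp', ENNReal.mul_rpow_of_nonneg _ _ hp',
          ENNReal.mul_rpow_of_nonneg ((2 ^ n) ^ p) _ hp', hrp, ← ENNReal.rpow_mul,
          mul_one_div_cancel hp₀.ne', ENNReal.rpow_one, dyadicNorm]
        ring

variable (K : CoeffKernels n k)

/-- At almost every point `g` is the limit of the approximations of `f` at the rate given by the
local approximations. Only this property of the trace enters the norm estimates, so that `g` can
be taken to be a Borel representative of the trace. -/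
def CoeffKernels.IsLimit (K : CoeffKernels n k) (μ : Measure (EuclideanSpace ℝ (Fin n))) (u : ℝ)
    (f g : EuclideanSpace ℝ (Fin n) → ℝ) : Prop :=
  ∀ᵐ y ∂μ, ∀ i, ‖g y - K.approx f i y‖ₑ ≤
    ENNReal.ofReal K.rate * cubeVol n univ * ∑' j : ℕ, dyadicErr k u f (i + j) y

lemma tail_norm_le (hf : Measurable f) (hfp : MemLp f (ENNReal.ofReal p) volume)
    (hu : 1 ≤ u) (hup : u ≤ p) (c : ℝ≥0∞) (i : ℕ) :
    (∫⁻ y, (c * ∑' j : ℕ, dyadicErr k u f (i + j) y) ^ p ∂μ) ^ (1 / p) ≤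
      c * ∑' j : ℕ, dyadicNorm μ k u p f (i + j) := by
  have hp₀ : 0 < p := by linarith
  have hm : ∀ j, Measurable (dyadicErr k u f (i + j)) :=
    fun j => measurable_dyadicErr hf hfp hu hup _
  simp_rw [ENNReal.mul_rpow_of_nonneg _ _ hp₀.le]
  rw [lintegral_const_mul _ ((Measurable.tsum hm).pow_const p),
    ENNReal.mul_rpow_of_nonneg _ _ (by positivity), ← ENNReal.rpow_mul,
    mul_one_div_cancel hp₀.ne', ENNReal.rpow_one]
  gcongr
  exact lintegral_Lp_tsum_le (hu.trans hup) hm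

/-- The `L^p(μ)` norm of the trace: telescope from the scale `1/2`, at which the approximation is
bounded by a mean of `f`. -/
lemma RegularOn.norm_limit_le [SFinite μ] (h : RegularOn μ S d c₁ c₂) (hf : Measurable f)
    (hfp : MemLp f (ENNReal.ofReal p) volume) (hu : 1 ≤ u) (hup : u ≤ p)
    {g : EuclideanSpace ℝ (Fin n) → ℝ} (hg : K.IsLimit μ u f g) :
    (∫⁻ y, ‖g y‖ₑ ^ p ∂μ) ^ (1 / p) ≤
      ENNReal.ofReal K.M * cubeVol n univ *
        (ENNReal.ofReal (c₂ * 2 ^ d) * (cubeVol n univ)⁻¹ *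
          ENNReal.ofReal ((1 / 2) ^ (d - n))) ^ (1 / p) * (∫⁻ z, ‖f z‖ₑ ^ p) ^ (1 / p) +
      ENNReal.ofReal K.rate * cubeVol n univ * ∑' j : ℕ, dyadicNorm μ k u p f (1 + j) := by
  have hp : 1 ≤ p := hu.trans hup
  have hp₀ : 0 < p := by linarith
  set H : EuclideanSpace ℝ (Fin n) → ℝ≥0∞ := fun y =>
    ENNReal.ofReal K.rate * cubeVol n univ * ∑' j : ℕ, dyadicErr k u f (1 + j) y with hH
  have hHm : Measurable H :=
    (Measurable.tsum fun j => measurable_dyadicErr hf hfp hu hup _).const_mul _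
  set G : EuclideanSpace ℝ (Fin n) → ℝ≥0∞ := fun y => ENNReal.ofReal K.M * cubeVol n univ *
    ((volume (cube y (1 / 2)))⁻¹ * ∫⁻ x in cube y (1 / 2), ‖f x‖ₑ ^ p) ^ (1 / p) with hG
  have hmm : Measurable fun y : EuclideanSpace ℝ (Fin n) =>
      (volume (cube y (1 / 2)))⁻¹ * ∫⁻ x in cube y (1 / 2), ‖f x‖ₑ ^ p := by
    simp_rw [volume_cube _ one_half_pos]
    exact (measurable_lintegral_cube volume (hf.enorm.pow_const p) _).const_mul _
  have hGm : Measurable G := (hmm.pow_const _).const_mul _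
  have hpt : ∀ᵐ y ∂μ, ‖g y‖ₑ ≤ (G + H) y := by
    filter_upwards [hg] with y hy
    have h₁ := K.enorm_approx_sub_eval_le (y := y) hf 1
      (integrable_rescaled hf hfp hp y (half_pow_pos 1)) zero_mem_polys
    simp only [map_zero, sub_zero, pow_one] at h₁
    have h₂ := lintegral_rescaled_le hf hp y one_half_pos
    calc ‖g y‖ₑ = ‖K.approx f 1 y + (g y - K.approx f 1 y)‖ₑ := by rw [add_sub_cancel]
      _ ≤ ‖K.approx f 1 y‖ₑ + ‖g y - K.approx f 1 y‖ₑ := enorm_add_le _ _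
      _ ≤ _ := by
        refine add_le_add (h₁.trans ?_) (hy 1)
        simp only [hG]
        rw [mul_assoc]
        gcongr
  calc (∫⁻ y, ‖g y‖ₑ ^ p ∂μ) ^ (1 / p) ≤ (∫⁻ y, (G + H) y ^ p ∂μ) ^ (1 / p) := by
        refine ENNReal.rpow_le_rpow (lintegral_mono_ae ?_) (by positivity)
        filter_upwards [hpt] with y hy
        gcongr
    _ ≤ (∫⁻ y, G y ^ p ∂μ) ^ (1 / p) + (∫⁻ y, H y ^ p ∂μ) ^ (1 / p) :=
        ENNReal.lintegral_Lp_add_le hGm.aemeasurable hHm.aemeasurable hp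
    _ ≤ _ := by
        refine add_le_add ?_ (tail_norm_le hf hfp hu hup _ 1)
        simp only [hG, ENNReal.mul_rpow_of_nonneg _ _ hp₀.le]
        simp_rw [← ENNReal.rpow_mul, one_div_mul_cancel hp₀.ne', ENNReal.rpow_one]
        rw [lintegral_const_mul _ hmm, ENNReal.mul_rpow_of_nonneg _ _ (by positivity),
          ENNReal.mul_rpow_of_nonneg _ _ (by positivity), ← ENNReal.rpow_mul, ← ENNReal.rpow_mul,
          mul_one_div_cancel hp₀.ne', ENNReal.rpow_one, ENNReal.rpow_one, mul_assoc _ (_ ^ (1 / p)),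
          ← ENNReal.mul_rpow_of_nonneg _ _ (by positivity)]
        gcongr
        exact h.lintegral_volume_mean_le (hf.enorm.pow_const p) one_half_pos le_rfl

/-- The crude bound at a fixed scale: the local approximation is at most a mean of `g`. -/
lemma RegularOn.approxNorm_le [SFinite μ] (h : RegularOn μ S d c₁ c₂)
    {g : EuclideanSpace ℝ (Fin n) → ℝ}
    (hg : Measurable g) (hu : 1 ≤ u) (hup : u ≤ p) {r : ℝ} (hr : 0 < r) (hr₁ : r ≤ 1) :
    approxNorm μ k u p g r ≤
      ENNReal.ofReal (c₂ / c₁) ^ (1 / p) * (∫⁻ y, ‖g y‖ₑ ^ p ∂μ) ^ (1 / p) := by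
  have hp₀ : 0 < p := by linarith
  rw [approxNorm, ← ENNReal.mul_rpow_of_nonneg _ _ (by positivity)]
  refine ENNReal.rpow_le_rpow ?_ (by positivity)
  refine (lintegral_mono_ae ?_).trans (h.lintegral_mean_le (hg.enorm.pow_const p) hr hr₁)
  filter_upwards [h.ae_mem] with x hx
  rw [← ENNReal.le_rpow_inv_iff hp₀, inv_eq_one_div p]
  exact localApprox_le_mean (h.measure_cube_ne_zero hx hr hr₁) (h.measure_cube_ne_top hx hr hr₁)
    hg hu hup

/-- On a cube centred on `S`, a polynomial close to `f` on the concentric cube of twice the size is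
close to the trace, with an error given by the finer local approximations at the points of `S`. -/
lemma RegularOn.localApprox_limit_le (h : RegularOn μ S d c₁ c₂) (hf : Measurable f)
    (hfp : MemLp f (ENNReal.ofReal p) volume) (hu : 1 ≤ u) (hup : u ≤ p)
    {g : EuclideanSpace ℝ (Fin n) → ℝ} (hg : K.IsLimit μ u f g) (i : ℕ)
    {x : EuclideanSpace ℝ (Fin n)} (hx : x ∈ S) :
    localApprox μ k u g (cube x ((1 / 2) ^ (i + 1))) ≤
      ((μ (cube x ((1 / 2) ^ (i + 1))))⁻¹ * ∫⁻ y in cube x ((1 / 2) ^ (i + 1)),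
        (ENNReal.ofReal K.rate * cubeVol n univ *
          ∑' j : ℕ, dyadicErr k u f (i + 1 + j) y) ^ p ∂μ) ^ (1 / p) +
      ENNReal.ofReal K.M * cubeVol n univ * 2 ^ n * dyadicErr k u f i x := by
  have hp : 1 ≤ p := hu.trans hup
  have hu₀ : 0 < u := by linarith
  set r : ℝ := (1 / 2) ^ (i + 1) with hr
  have hr₀ : 0 < r := half_pow_pos _
  have h2r : (1 / 2 : ℝ) ^ i = 2 * r := by rw [hr, pow_succ]; ring
  have hμ₀ := h.measure_cube_ne_zero hx hr₀ (half_pow_le_one _)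
  have hμ := h.measure_cube_ne_top hx hr₀ (half_pow_le_one _)
  set H : EuclideanSpace ℝ (Fin n) → ℝ≥0∞ := fun y =>
    ENNReal.ofReal K.rate * cubeVol n univ * ∑' j : ℕ, dyadicErr k u f (i + 1 + j) y with hH
  have hHm : Measurable H :=
    (Measurable.tsum fun j => measurable_dyadicErr hf hfp hu hup _).const_mul _
  have hc₀ : ENNReal.ofReal K.M * cubeVol n univ * 2 ^ n ≠ 0 :=
    mul_ne_zero (mul_ne_zero (ENNReal.ofReal_pos.2 K.M_pos).ne' cubeVol_univ_pos.ne') (by simp)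
  have hc : ENNReal.ofReal K.M * cubeVol n univ * 2 ^ n ≠ ∞ := by finiteness
  rw [← tsub_le_iff_left, ← ENNReal.inv_mul_le_iff hc₀ hc]
  refine le_iInf₂ fun P hP => ?_
  rw [ENNReal.inv_mul_le_iff hc₀ hc, tsub_le_iff_left]
  set D : ℝ≥0∞ := ((volume (cube x ((1 / 2) ^ i)))⁻¹ * ∫⁻ y in cube x ((1 / 2) ^ i),
    ‖f y - MvPolynomial.eval (fun i => y i) P‖ₑ ^ u) ^ (1 / u) with hD
  have hdm : Measurable fun y => f y - MvPolynomial.eval (fun i => y i) P :=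
    hf.sub (measurable_eval_poly P)
  set B : EuclideanSpace ℝ (Fin n) → ℝ≥0∞ :=
    fun _ => ENNReal.ofReal K.M * cubeVol n univ * 2 ^ n * D with hB
  have hpt : ∀ᵐ y ∂μ.restrict (cube x r), ‖g y - MvPolynomial.eval (fun i => y i) P‖ₑ ≤
      (H + B) y := by
    filter_upwards [ae_restrict_of_ae hg, ae_restrict_mem (measurableSet_cube x r)] with y hy hyx
    have h₁ := K.enorm_approx_sub_eval_le (y := y) hf (i + 1)
      (integrable_rescaled hf hfp hp y (half_pow_pos (i + 1))) hP
    have h₂ := lintegral_rescaled_le hdm hu y hr₀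
    have h₃ : ((volume (cube y r))⁻¹ * ∫⁻ y in cube y r,
        ‖f y - MvPolynomial.eval (fun i => y i) P‖ₑ ^ u) ^ (1 / u) ≤ 2 ^ n * D := by
      -- with `k = 0` the local approximation is the mean of the function itself
      have h₄ := localApprox_le_two_pow_mul (k := 0)
        (f := fun y => f y - MvPolynomial.eval (fun i => y i) P) hu hr₀ (half_pow_pos i) h2r.le
        (cube_subset_cube (t := (1 / 2) ^ i) hyx (by linarith))
      have h₅ : polys n 0 = {0} := by ext; simp [polys]
      simpa only [localApprox, h₅, mem_singleton_iff, iInf_iInf_eq_left, map_zero, sub_zero]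
        using h₄
    calc ‖g y - MvPolynomial.eval (fun i => y i) P‖ₑ
        = ‖(g y - K.approx f (i + 1) y) +
            (K.approx f (i + 1) y - MvPolynomial.eval (fun i => y i) P)‖ₑ := by
          rw [sub_add_sub_cancel]
      _ ≤ _ := (enorm_add_le _ _).trans (add_le_add (hy (i + 1)) (h₁.trans ?_))
    simp only [hB]
    rw [mul_assoc, mul_assoc]
    gcongr
    exact h₂.trans (by gcongr)
  have hprob : IsProbabilityMeasure ((μ (cube x r))⁻¹ • μ.restrict (cube x r)) :=
    ⟨by simpa using ENNReal.inv_mul_cancel hμ₀ hμ⟩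
  refine (iInf₂_le P hP).trans ?_
  calc ((μ (cube x r))⁻¹ * ∫⁻ y in cube x r,
        ‖g y - MvPolynomial.eval (fun i => y i) P‖ₑ ^ u ∂μ) ^ (1 / u)
      ≤ ((μ (cube x r))⁻¹ * ∫⁻ y in cube x r,
        (H + B) y ^ u ∂μ) ^ (1 / u) := by
        refine ENNReal.rpow_le_rpow ?_ (by positivity)
        gcongr 1
        refine lintegral_mono_ae ?_
        filter_upwards [hpt] with y hy
        gcongr
    _ ≤ ((μ (cube x r))⁻¹ * ∫⁻ y in cube x r, H y ^ u ∂μ) ^ (1 / u) +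
        ENNReal.ofReal K.M * cubeVol n univ * 2 ^ n * D := by
        have h₆ := ENNReal.lintegral_Lp_add_le
          (μ := (μ (cube x r))⁻¹ • μ.restrict (cube x r)) hHm.aemeasurable
          (g := B) measurable_const.aemeasurable hu
        rw [hB, lintegral_const, hprob.measure_univ, mul_one, ← ENNReal.rpow_mul,
          mul_one_div_cancel hu₀.ne', ENNReal.rpow_one] at h₆
        simpa only [lintegral_smul_measure, smul_eq_mul] using h₆
    _ ≤ _ := by
        gcongr
        exact laverage_rpow_le hμ₀ hμ hHm hu₀ hup

lemma RegularOn.approxNorm_limit_le [SFinite μ] (h : RegularOn μ S d c₁ c₂) (hf : Measurable f)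
    (hfp : MemLp f (ENNReal.ofReal p) volume) (hu : 1 ≤ u) (hup : u ≤ p)
    {g : EuclideanSpace ℝ (Fin n) → ℝ} (hg : K.IsLimit μ u f g) (i : ℕ) :
    approxNorm μ k u p g ((1 / 2) ^ (i + 1)) ≤
      (ENNReal.ofReal (c₂ / c₁) ^ (1 / p) * (ENNReal.ofReal K.rate * cubeVol n univ) +
        ENNReal.ofReal K.M * cubeVol n univ * 2 ^ n) *
      ∑' j : ℕ, dyadicNorm μ k u p f (i + j) := by
  have hp : 1 ≤ p := hu.trans hup
  have hp₀ : 0 < p := by linarith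
  set r : ℝ := (1 / 2) ^ (i + 1) with hr
  have hr₀ : 0 < r := half_pow_pos _
  set H : EuclideanSpace ℝ (Fin n) → ℝ≥0∞ := fun y =>
    ENNReal.ofReal K.rate * cubeVol n univ * ∑' j : ℕ, dyadicErr k u f (i + 1 + j) y with hH
  have hHm : Measurable H :=
    (Measurable.tsum fun j => measurable_dyadicErr hf hfp hu hup _).const_mul _
  set G : EuclideanSpace ℝ (Fin n) → ℝ≥0∞ := fun x =>
    ((μ (cube x r))⁻¹ * ∫⁻ y in cube x r, H y ^ p ∂μ) ^ (1 / p) with hG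
  have hGm : Measurable G := by
    have hμm : Measurable fun x => μ (cube x r) := by
      simpa using measurable_lintegral_cube μ (F := fun _ => 1) measurable_const r
    exact (hμm.inv.mul (measurable_lintegral_cube μ (hHm.pow_const p) r)).pow_const _
  have hm := measurable_dyadicErr (k := k) hf hfp hu hup i
  have hsplit : ∑' j : ℕ, dyadicNorm μ k u p f (i + j) =
      dyadicNorm μ k u p f i + ∑' j : ℕ, dyadicNorm μ k u p f (i + 1 + j) := by
    rw [tsum_eq_zero_add' ENNReal.summable]
    simp only [add_zero, add_assoc, add_comm 1]
  have hG' : (∫⁻ x, G x ^ p ∂μ) ^ (1 / p) ≤ ENNReal.ofReal (c₂ / c₁) ^ (1 / p) *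
      (ENNReal.ofReal K.rate * cubeVol n univ * ∑' j : ℕ, dyadicNorm μ k u p f (i + 1 + j)) := by
    refine le_trans ?_ (mul_le_mul_right (tail_norm_le hf hfp hu hup _ (i + 1)) _)
    rw [← ENNReal.mul_rpow_of_nonneg _ _ (by positivity)]
    simp_rw [hG, ← ENNReal.rpow_mul, one_div_mul_cancel hp₀.ne', ENNReal.rpow_one]
    exact ENNReal.rpow_le_rpow
      (h.lintegral_mean_le (hHm.pow_const p) hr₀ (half_pow_le_one _)) (by positivity)
  calc approxNorm μ k u p g r
      ≤ (∫⁻ x, (G + fun x => ENNReal.ofReal K.M * cubeVol n univ * 2 ^ n * dyadicErr k u f i x) x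
          ^ p ∂μ) ^ (1 / p) := by
        refine ENNReal.rpow_le_rpow (lintegral_mono_ae ?_) (by positivity)
        filter_upwards [h.ae_mem] with x hx
        exact ENNReal.rpow_le_rpow (h.localApprox_limit_le K hf hfp hu hup hg i hx) hp₀.le
    _ ≤ (∫⁻ x, G x ^ p ∂μ) ^ (1 / p) + (∫⁻ x, (ENNReal.ofReal K.M * cubeVol n univ * 2 ^ n *
          dyadicErr k u f i x) ^ p ∂μ) ^ (1 / p) :=
        ENNReal.lintegral_Lp_add_le hGm.aemeasurable (hm.const_mul _).aemeasurable hp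
    _ ≤ ENNReal.ofReal (c₂ / c₁) ^ (1 / p) * (ENNReal.ofReal K.rate * cubeVol n univ *
          ∑' j : ℕ, dyadicNorm μ k u p f (i + 1 + j)) +
        ENNReal.ofReal K.M * cubeVol n univ * 2 ^ n * dyadicNorm μ k u p f i := by
        refine add_le_add hG' (le_of_eq ?_)
        simp_rw [ENNReal.mul_rpow_of_nonneg _ _ hp₀.le]
        rw [lintegral_const_mul _ (hm.pow_const p), ENNReal.mul_rpow_of_nonneg _ _ (by positivity),
          ← ENNReal.mul_rpow_of_nonneg _ _ hp₀.le, ← ENNReal.mul_rpow_of_nonneg _ _ hp₀.le,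
          ← ENNReal.rpow_mul, mul_one_div_cancel hp₀.ne', ENNReal.rpow_one, dyadicNorm]
    _ ≤ _ := by
        rw [add_mul, ← mul_assoc]
        refine add_le_add (mul_le_mul_right ?_ _) (mul_le_mul_right ?_ _)
        · rw [hsplit]; exact le_add_self
        · rw [hsplit]; exact le_self_add

end Estimates

/-! ### Summation over scales -/

section Scales

lemma two_rpow_neg_natCast (j : ℕ) : (2 : ℝ) ^ (-(j : ℝ)) = (1 / 2) ^ j := by
  rw [Real.rpow_neg two_pos.le, Real.rpow_natCast, one_div, inv_pow]

lemma tsum_two_rpow_ne_top {s : ℝ} (hs : 0 < s) :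
    ∑' m : ℕ, ENNReal.ofReal (2 ^ (-((m : ℝ) * s))) ≠ ∞ := by
  have h : ∀ m : ℕ, ENNReal.ofReal (2 ^ (-((m : ℝ) * s))) = ENNReal.ofReal (2 ^ (-s)) ^ m := by
    intro m
    rw [← ENNReal.ofReal_pow (by positivity), ← Real.rpow_natCast, ← Real.rpow_mul two_pos.le]
    congr 2
    ring
  simp_rw [h]
  rw [ENNReal.tsum_geometric, ENNReal.inv_ne_top, ← ENNReal.ofReal_one,
    ← ENNReal.ofReal_sub _ (by positivity)]
  simpa using Real.rpow_lt_one_of_one_lt_of_neg one_lt_two (neg_lt_zero.2 hs)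

lemma tsum_rpow_le_zero_add {q : ℝ} (hq : 1 ≤ q) (x : ℕ → ℝ≥0∞) :
    (∑' i, x i ^ q) ^ (1 / q) ≤ x 0 + (∑' i, x (i + 1) ^ q) ^ (1 / q) := by
  have hq₀ : 0 < q := by linarith
  rw [tsum_eq_zero_add' ENNReal.summable]
  refine (ENNReal.rpow_add_le_add_rpow _ _ (by positivity) ((div_le_one hq₀).2 hq)).trans ?_
  rw [← ENNReal.rpow_mul, mul_one_div_cancel hq₀.ne', ENNReal.rpow_one]

lemma le_tsum_rpow {q : ℝ} (hq : 0 < q) (a : ℕ → ℝ≥0∞) (j : ℕ) :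
    a j ≤ (∑' i, a i ^ q) ^ (1 / q) := by
  rw [one_div, ENNReal.le_rpow_inv_iff hq]
  exact ENNReal.le_tsum j

variable {n k : ℕ} {u p q α : ℝ} {f : EuclideanSpace ℝ (Fin n) → ℝ}

lemma discreteBesov_volume_eq (s : ℝ) :
    discreteBesov volume k u p q s f = (∑' j : ℕ, (ENNReal.ofReal ((2 : ℝ) ^ ((j : ℝ) * s)) *
      dyadicNorm volume k u p f j) ^ q) ^ (1 / q) := by
  simp only [discreteBesov, approxNorm, dyadicNorm, dyadicErr, two_rpow_neg_natCast]

lemma eLpNorm_ofReal {μ : Measure (EuclideanSpace ℝ (Fin n))} (hp : 0 < p) :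
    eLpNorm f (ENNReal.ofReal p) μ = (∫⁻ y, ‖f y‖ₑ ^ p ∂μ) ^ (1 / p) := by
  rw [eLpNorm_eq_lintegral_rpow_enorm_toReal (by simpa using hp) ENNReal.ofReal_ne_top,
    ENNReal.toReal_ofReal hp.le]

variable {μ : Measure (EuclideanSpace ℝ (Fin n))} {S : Set (EuclideanSpace ℝ (Fin n))}
  {d c₁ c₂ : ℝ}

/-- The constant in the comparison of the local approximations on `S` and on `ℝⁿ`. -/
noncomputable def scaleConst (n : ℕ) (d p c₂ : ℝ) : ℝ≥0∞ :=
  2 ^ n * (ENNReal.ofReal (c₂ * 2 ^ d) * (cubeVol n univ)⁻¹) ^ (1 / p) *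
    ENNReal.ofReal (2 ^ ((n - d) / p))

lemma scaleConst_ne_top (hp : 0 < p) : scaleConst n d p c₂ ≠ ∞ := by
  have h₁ : (cubeVol n univ)⁻¹ ≠ ∞ := ENNReal.inv_ne_top.2 cubeVol_univ_pos.ne'
  have h₂ : (ENNReal.ofReal (c₂ * 2 ^ d) * (cubeVol n univ)⁻¹) ^ (1 / p) ≠ ∞ :=
    ENNReal.rpow_ne_top_of_nonneg (by positivity) (ENNReal.mul_ne_top ENNReal.ofReal_ne_top h₁)
  rw [scaleConst]
  finiteness

/-- With the weights of the two Besov norms, passing from `ℝⁿ` to `S` gains a factor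
`2 ^ (-m s)` between the scales `i + m` and `i`, where `s = α - (n - d) / p` is the smoothness of
the trace. -/
lemma RegularOn.weight_mul_dyadicNorm_le [SFinite μ] (h : RegularOn μ S d c₁ c₂)
    (hf : Measurable f) (hfp : MemLp f (ENNReal.ofReal p) volume) (hu : 1 ≤ u) (hup : u ≤ p)
    (α : ℝ) (i m : ℕ) :
    ENNReal.ofReal (2 ^ ((i : ℝ) * (α - (n - d) / p))) * dyadicNorm μ k u p f (i + 1 + m) ≤
      scaleConst n d p c₂ * (ENNReal.ofReal (2 ^ (-((m : ℝ) * (α - (n - d) / p)))) *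
        (ENNReal.ofReal (2 ^ (((i + m : ℕ) : ℝ) * α)) * dyadicNorm volume k u p f (i + m))) := by
  have h₁ := h.dyadicNorm_succ_le (k := k) hf hfp hu hup (i + m)
  rw [add_right_comm i 1 m]
  refine (mul_le_mul_right h₁ _).trans_eq ?_
  have h₂ : ENNReal.ofReal (2 ^ ((i : ℝ) * (α - (n - d) / p))) *
      ENNReal.ofReal (2 ^ ((((i + m : ℕ) : ℝ) + 1) * ((n - d) / p))) =
      ENNReal.ofReal (2 ^ ((n - d) / p)) * (ENNReal.ofReal (2 ^ (-((m : ℝ) * (α - (n - d) / p)))) *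
        ENNReal.ofReal (2 ^ (((i + m : ℕ) : ℝ) * α))) := by
    rw [← ENNReal.ofReal_mul (by positivity), ← ENNReal.ofReal_mul (by positivity),
      ← ENNReal.ofReal_mul (by positivity), ← Real.rpow_add two_pos, ← Real.rpow_add two_pos,
      ← Real.rpow_add two_pos]
    congr 2
    push_cast
    ring
  rw [scaleConst]
  calc _ = 2 ^ n * (ENNReal.ofReal (c₂ * 2 ^ d) * (cubeVol n univ)⁻¹) ^ (1 / p) *
        (ENNReal.ofReal (2 ^ ((i : ℝ) * (α - (n - d) / p))) *
          ENNReal.ofReal (2 ^ ((((i + m : ℕ) : ℝ) + 1) * ((n - d) / p)))) *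
        dyadicNorm volume k u p f (i + m) := by ring
    _ = _ := by rw [h₂]; ring

lemma RegularOn.tsum_dyadicNorm_le [SFinite μ] (h : RegularOn μ S d c₁ c₂)
    (hf : Measurable f) (hfp : MemLp f (ENNReal.ofReal p) volume) (hu : 1 ≤ u) (hup : u ≤ p)
    (hq : 1 ≤ q) :
    ∑' j : ℕ, dyadicNorm μ k u p f (1 + j) ≤ scaleConst n d p c₂ *
      (∑' m : ℕ, ENNReal.ofReal (2 ^ (-((m : ℝ) * (α - (n - d) / p))))) *
        discreteBesov volume k u p q α f := by
  rw [mul_assoc, ← ENNReal.tsum_mul_right, ← ENNReal.tsum_mul_left]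
  refine ENNReal.tsum_le_tsum fun m => ?_
  have h₁ := h.weight_mul_dyadicNorm_le (k := k) hf hfp hu hup α 0 m
  simp only [Nat.cast_zero, zero_mul, Real.rpow_zero, ENNReal.ofReal_one, one_mul, zero_add] at h₁
  refine h₁.trans ?_
  rw [discreteBesov_volume_eq]
  gcongr
  exact le_tsum_rpow (by linarith)
    (fun j : ℕ => ENNReal.ofReal (2 ^ ((j : ℝ) * α)) * dyadicNorm volume k u p f j) m

/-- The Besov seminorm of the trace. The two coarsest scales are bounded by the `L^p` norm, since
the estimate at scale `2 ^ (-i)` uses the scale `2 ^ (2 - i)` on `ℝⁿ`. -/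
lemma RegularOn.discreteBesov_limit_le [SFinite μ] (h : RegularOn μ S d c₁ c₂)
    (K : CoeffKernels n k) (hf : Measurable f) (hfp : MemLp f (ENNReal.ofReal p) volume)
    (hu : 1 ≤ u) (hup : u ≤ p) (hq : 1 ≤ q) {g : EuclideanSpace ℝ (Fin n) → ℝ}
    (hgm : Measurable g) (hg : K.IsLimit μ u f g) :
    discreteBesov μ k u p q (α - (n - d) / p) g ≤
      (1 + ENNReal.ofReal (2 ^ (α - (n - d) / p))) * ENNReal.ofReal (c₂ / c₁) ^ (1 / p) *
        (∫⁻ y, ‖g y‖ₑ ^ p ∂μ) ^ (1 / p) +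
      ENNReal.ofReal (2 ^ (2 * (α - (n - d) / p))) *
        (ENNReal.ofReal (c₂ / c₁) ^ (1 / p) * (ENNReal.ofReal K.rate * cubeVol n univ) +
          ENNReal.ofReal K.M * cubeVol n univ * 2 ^ n) * scaleConst n d p c₂ *
        (∑' m : ℕ, ENNReal.ofReal (2 ^ (-((m : ℝ) * (α - (n - d) / p))))) *
        discreteBesov volume k u p q α f := by
  have hq₀ : 0 < q := by linarith
  set s := α - (n - d) / p with hs
  set D := ENNReal.ofReal (c₂ / c₁) ^ (1 / p) * (ENNReal.ofReal K.rate * cubeVol n univ) +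
    ENNReal.ofReal K.M * cubeVol n univ * 2 ^ n with hD
  set a : ℕ → ℝ≥0∞ := fun j =>
    ENNReal.ofReal (2 ^ ((j : ℝ) * α)) * dyadicNorm volume k u p f j with ha
  set c : ℕ → ℝ≥0∞ := fun m => ENNReal.ofReal (2 ^ (-((m : ℝ) * s))) with hc
  set x : ℕ → ℝ≥0∞ := fun i =>
    ENNReal.ofReal (2 ^ ((i : ℝ) * s)) * approxNorm μ k u p g ((1 / 2) ^ i) with hx
  have hcrude : ∀ i, approxNorm μ k u p g ((1 / 2) ^ i) ≤
      ENNReal.ofReal (c₂ / c₁) ^ (1 / p) * (∫⁻ y, ‖g y‖ₑ ^ p ∂μ) ^ (1 / p) :=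
    fun i => h.approxNorm_le hgm hu hup (half_pow_pos i) (half_pow_le_one i)
  have hx2 : ∀ i, x (i + 1 + 1) ≤
      ENNReal.ofReal (2 ^ (2 * s)) * D * scaleConst n d p c₂ * ∑' m, c m * a (i + m) := by
    intro i
    have h₁ := h.approxNorm_limit_le K hf hfp hu hup hg (i + 1)
    rw [← hD] at h₁
    have h₂ : ENNReal.ofReal (2 ^ (((i + 1 + 1 : ℕ) : ℝ) * s)) =
        ENNReal.ofReal (2 ^ (2 * s)) * ENNReal.ofReal (2 ^ ((i : ℝ) * s)) := by
      rw [← ENNReal.ofReal_mul (by positivity), ← Real.rpow_add two_pos]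
      congr 2
      push_cast
      ring
    calc x (i + 1 + 1) ≤ ENNReal.ofReal (2 ^ (2 * s)) * ENNReal.ofReal (2 ^ ((i : ℝ) * s)) *
          (D * ∑' m : ℕ, dyadicNorm μ k u p f (i + 1 + m)) := by
          rw [← h₂]
          exact mul_le_mul_right h₁ _
      _ = ENNReal.ofReal (2 ^ (2 * s)) * D *
          ∑' m : ℕ, ENNReal.ofReal (2 ^ ((i : ℝ) * s)) * dyadicNorm μ k u p f (i + 1 + m) := by
          rw [ENNReal.tsum_mul_left]; ring
      _ ≤ ENNReal.ofReal (2 ^ (2 * s)) * D *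
          ∑' m : ℕ, scaleConst n d p c₂ * (c m * a (i + m)) := by
          refine mul_le_mul_right (ENNReal.tsum_le_tsum fun m => ?_) _
          exact h.weight_mul_dyadicNorm_le hf hfp hu hup α i m
      _ = _ := by rw [ENNReal.tsum_mul_left]; ring
  have htail : (∑' i, x (i + 1 + 1) ^ q) ^ (1 / q) ≤
      ENNReal.ofReal (2 ^ (2 * s)) * D * scaleConst n d p c₂ *
        ((∑' m, c m) * (∑' j, a j ^ q) ^ (1 / q)) := by
    refine le_trans ?_ (mul_le_mul_right (tsum_rpow_tsum_shift_le hq c a) _)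
    calc (∑' i, x (i + 1 + 1) ^ q) ^ (1 / q)
        ≤ (∑' i, (ENNReal.ofReal (2 ^ (2 * s)) * D * scaleConst n d p c₂ *
            ∑' m, c m * a (i + m)) ^ q) ^ (1 / q) := by
          gcongr with i
          exact hx2 i
      _ = _ := by
          simp_rw [ENNReal.mul_rpow_of_nonneg _ _ hq₀.le]
          rw [ENNReal.tsum_mul_left, ← ENNReal.mul_rpow_of_nonneg _ _ hq₀.le,
            ← ENNReal.mul_rpow_of_nonneg _ _ hq₀.le,
            ENNReal.mul_rpow_of_nonneg _ _ (by positivity), ← ENNReal.rpow_mul,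
            mul_one_div_cancel hq₀.ne', ENNReal.rpow_one]
  have hbesov : discreteBesov μ k u p q s g = (∑' i, x i ^ q) ^ (1 / q) := by
    simp only [discreteBesov, two_rpow_neg_natCast, hx]
  rw [hbesov, discreteBesov_volume_eq]
  calc (∑' i, x i ^ q) ^ (1 / q) ≤ x 0 + (x 1 + (∑' i, x (i + 1 + 1) ^ q) ^ (1 / q)) :=
        (tsum_rpow_le_zero_add hq x).trans
          (add_le_add_right (tsum_rpow_le_zero_add hq fun i => x (i + 1)) _)
    _ ≤ 1 * (ENNReal.ofReal (c₂ / c₁) ^ (1 / p) * (∫⁻ y, ‖g y‖ₑ ^ p ∂μ) ^ (1 / p)) +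
        (ENNReal.ofReal (2 ^ s) *
          (ENNReal.ofReal (c₂ / c₁) ^ (1 / p) * (∫⁻ y, ‖g y‖ₑ ^ p ∂μ) ^ (1 / p)) +
        ENNReal.ofReal (2 ^ (2 * s)) * D * scaleConst n d p c₂ *
        ((∑' m, c m) * (∑' j, a j ^ q) ^ (1 / q))) := by
        refine add_le_add ?_ (add_le_add ?_ htail)
        · simpa [hx] using hcrude 0
        · simp only [hx, Nat.cast_one, one_mul]
          exact mul_le_mul_right (hcrude 1) _
    _ = _ := by ring

end Scales

/-! ### Existence of the trace -/

section Existence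

variable {n k : ℕ} {u p q α : ℝ} {f : EuclideanSpace ℝ (Fin n) → ℝ}
  {μ : Measure (EuclideanSpace ℝ (Fin n))} {S : Set (EuclideanSpace ℝ (Fin n))} {d c₁ c₂ : ℝ}

/-- If the local approximations at the scales `2 ^ (-j)` are summable in `L^p(μ)`, then the trace
exists almost everywhere and is approximated at the expected rate. -/
lemma exists_measurable_trace (K : CoeffKernels n k) (hf : Measurable f)
    (hfp : MemLp f (ENNReal.ofReal p) volume) (hu : 1 ≤ u) (hup : u ≤ p)
    (hs : ∑' j : ℕ, dyadicNorm μ k u p f (1 + j) ≠ ∞) :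
    (∀ᵐ y ∂μ, ∃ l, HasTraceAt f y l) ∧
      ∃ g, Measurable g ∧ trace f =ᵐ[μ] g ∧ K.IsLimit μ u f g := by
  have hp : 1 ≤ p := hu.trans hup
  have hp₀ : 0 < p := by linarith
  have hsum : ∀ᵐ y ∂μ, ∑' j : ℕ, dyadicErr k u f (1 + j) y < ∞ := by
    have h₁ := tail_norm_le (μ := μ) (k := k) hf hfp hu hup 1 1
    simp only [one_mul] at h₁
    have h₂ : ∫⁻ y, (∑' j : ℕ, dyadicErr k u f (1 + j) y) ^ p ∂μ ≠ ∞ := by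
      intro h
      rw [h, ENNReal.top_rpow_of_pos (by positivity), top_le_iff] at h₁
      exact hs h₁
    have hm : Measurable fun y => ∑' j : ℕ, dyadicErr k u f (1 + j) y :=
      Measurable.tsum fun j => measurable_dyadicErr hf hfp hu hup _
    filter_upwards [ae_lt_top (hm.pow_const p) h₂] with y hy
    by_contra h
    rw [not_lt, top_le_iff] at h
    rw [h, ENNReal.top_rpow_of_pos hp₀] at hy
    exact lt_irrefl _ hy
  have hle : ∀ i y, polyErr k (fun z => f (y + (1 / 2 : ℝ) ^ i • z)) ≤
      cubeVol n univ * dyadicErr k u f i y :=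
    fun i y => polyErr_le_localApprox hf hu y (half_pow_pos i)
  have hlim : ∀ᵐ y ∂μ, ∃ l, HasTraceAt f y l ∧ Tendsto (fun j => K.approx f j y) atTop (𝓝 l) ∧
      ∀ i, ‖l - K.approx f i y‖ₑ ≤ ENNReal.ofReal K.rate * cubeVol n univ *
        ∑' j : ℕ, dyadicErr k u f (i + j) y := by
    filter_upwards [hsum] with y hy
    have hi := fun j : ℕ => integrable_rescaled hf hfp hp y (half_pow_pos j)
    have hfin : ∑' j : ℕ, polyErr k (fun z => f (y + (1 / 2 : ℝ) ^ j • z)) ≠ ∞ := by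
      rw [tsum_eq_zero_add' ENNReal.summable]
      refine ENNReal.add_ne_top.2 ⟨?_, ?_⟩
      · refine ((iInf₂_le 0 zero_mem_polys).trans_lt ?_).ne
        simpa [hasFiniteIntegral_iff_enorm] using (hi 0).hasFiniteIntegral
      · refine ne_top_of_le_ne_top (ENNReal.mul_ne_top (measure_ne_top (cubeVol n) univ) hy.ne) ?_
        rw [← ENNReal.tsum_mul_left]
        refine ENNReal.tsum_le_tsum fun j => ?_
        rw [add_comm j 1]
        exact hle (1 + j) y
    obtain ⟨l, h₁, h₂, h₃⟩ := K.exists_hasTraceAt hf hi hfin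
    refine ⟨l, h₁, h₂, fun i => (h₃ i).trans ?_⟩
    rw [mul_assoc, ← ENNReal.tsum_mul_left (a := cubeVol n univ)]
    gcongr with j
    exact hle (i + j) y
  have hae : AEMeasurable (trace f) μ := by
    refine aemeasurable_of_tendsto_metrizable_ae atTop
      (fun j => (K.measurable_approx hf j).aemeasurable) ?_
    filter_upwards [hlim] with y hy
    obtain ⟨l, h₁, h₂, -⟩ := hy
    rwa [h₁.trace_eq]
  refine ⟨?_, hae.mk _, hae.measurable_mk, hae.ae_eq_mk, ?_⟩
  · filter_upwards [hlim] with y ⟨l, h₁, _⟩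
    exact ⟨l, h₁⟩
  · filter_upwards [hlim, hae.ae_eq_mk] with y ⟨l, h₁, _, h₃⟩ hy
    rw [← hy, h₁.trace_eq]
    exact h₃

/-- The trace theorem for Borel functions with finite discrete Besov seminorm. The constant is
chosen before `f`, and existence of the trace needs only the finiteness of the seminorm for one
choice of `k` and `u`. -/
theorem RegularOn.trace_bound [SFinite μ] (h : RegularOn μ S d c₁ c₂) (k : ℕ) (hu : 1 ≤ u)
    (hup : u ≤ p) (hq : 1 ≤ q) (hα : (n - d) / p < α) :
    ∃ C : ℝ≥0∞, C ≠ ∞ ∧ ∀ f : EuclideanSpace ℝ (Fin n) → ℝ, Measurable f →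
      MemLp f (ENNReal.ofReal p) volume → discreteBesov volume k u p q α f ≠ ∞ →
      (∀ᵐ y ∂μ, ∃ l, HasTraceAt f y l) ∧ MemLp (trace f) (ENNReal.ofReal p) μ ∧
      discreteBesov μ k u p q (α - (n - d) / p) (trace f) +
          eLpNorm (trace f) (ENNReal.ofReal p) μ ≤
        C * (discreteBesov volume k u p q α f + eLpNorm f (ENNReal.ofReal p) volume) := by
  obtain ⟨K⟩ := nonempty_coeffKernels n k
  have hp₀ : 0 < p := by linarith
  have hp' : 0 ≤ 1 / p := by positivity
  have hV : (cubeVol n univ)⁻¹ ≠ ∞ := ENNReal.inv_ne_top.2 cubeVol_univ_pos.ne'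
  have hVt : cubeVol n univ ≠ ∞ := measure_ne_top _ _
  have hgeom := tsum_two_rpow_ne_top (sub_pos.2 hα)
  have hsc : scaleConst n d p c₂ ≠ ∞ := scaleConst_ne_top hp₀
  set σ := ∑' m : ℕ, ENNReal.ofReal (2 ^ (-((m : ℝ) * (α - (n - d) / p))))
  set A := ENNReal.ofReal K.M * cubeVol n univ *
    (ENNReal.ofReal (c₂ * 2 ^ d) * (cubeVol n univ)⁻¹ *
      ENNReal.ofReal ((1 / 2) ^ (d - n))) ^ (1 / p)
  set B := ENNReal.ofReal K.rate * cubeVol n univ * (scaleConst n d p c₂ * σ)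
  set E₁ := (1 + ENNReal.ofReal (2 ^ (α - (n - d) / p))) * ENNReal.ofReal (c₂ / c₁) ^ (1 / p)
  set E₂ := ENNReal.ofReal (2 ^ (2 * (α - (n - d) / p))) *
    (ENNReal.ofReal (c₂ / c₁) ^ (1 / p) * (ENNReal.ofReal K.rate * cubeVol n univ) +
      ENNReal.ofReal K.M * cubeVol n univ * 2 ^ n) * scaleConst n d p c₂ * σ
  have hcc : ENNReal.ofReal (c₂ / c₁) ^ (1 / p) ≠ ∞ :=
    ENNReal.rpow_ne_top_of_nonneg hp' ENNReal.ofReal_ne_top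
  have hA : A ≠ ∞ := ENNReal.mul_ne_top (by finiteness) (ENNReal.rpow_ne_top_of_nonneg hp'
    (ENNReal.mul_ne_top (ENNReal.mul_ne_top ENNReal.ofReal_ne_top hV) ENNReal.ofReal_ne_top))
  have hB : B ≠ ∞ := by finiteness
  have hE₁ : E₁ ≠ ∞ := by finiteness
  have hE₂ : E₂ ≠ ∞ := by finiteness
  refine ⟨(E₁ + 1) * (A + B) + E₂, by finiteness, fun f hf hfp hfin => ?_⟩
  have htsum := h.tsum_dyadicNorm_le (k := k) (q := q) (α := α) hf hfp hu hup hq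
  obtain ⟨hex, g, hgm, hfg, hg⟩ := exists_measurable_trace K hf hfp hu hup
    (ne_top_of_le_ne_top (by finiteness) htsum)
  have hnorm := h.norm_limit_le K hf hfp hu hup hg
  have hbes := h.discreteBesov_limit_le (q := q) (α := α) K hf hfp hu hup hq hgm hg
  rw [← eLpNorm_ofReal hp₀] at hnorm hbes
  rw [← eLpNorm_ofReal hp₀] at hnorm
  set X := discreteBesov volume k u p q α f
  set Y := eLpNorm f (ENNReal.ofReal p) volume
  set Z := eLpNorm g (ENNReal.ofReal p) μ with hZ
  have hZle : Z ≤ A * Y + B * X := by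
    refine hnorm.trans (add_le_add le_rfl ?_)
    rw [mul_assoc _ (scaleConst n d p c₂ * σ) X]
    exact mul_le_mul_right htsum _
  have hgp : MemLp g (ENNReal.ofReal p) μ := by
    refine ⟨hgm.aestronglyMeasurable, hZle.trans_lt ?_⟩
    have hY : Y ≠ ∞ := hfp.2.ne
    exact lt_top_iff_ne_top.2 (by finiteness)
  refine ⟨hex, (memLp_congr_ae hfg).2 hgp, ?_⟩
  have hcongr : discreteBesov μ k u p q (α - (n - d) / p) (trace f) =
      discreteBesov μ k u p q (α - (n - d) / p) g := by
    simp only [discreteBesov, approxNorm, localApprox_congr_ae hfg]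
  rw [hcongr, eLpNorm_congr_ae hfg, ← hZ]
  have hX : X ≤ X + Y := le_self_add
  have hZle' : Z ≤ (A + B) * (X + Y) := by
    refine hZle.trans ?_
    rw [add_mul]
    exact add_le_add (mul_le_mul_right le_add_self _) (mul_le_mul_right hX _)
  calc _ ≤ (E₁ * Z + E₂ * X) + Z := add_le_add hbes le_rfl
    _ = (E₁ + 1) * Z + E₂ * X := by ring
    _ ≤ (E₁ + 1) * ((A + B) * (X + Y)) + E₂ * (X + Y) := by gcongr
    _ = _ := by ring

end Existence

/-! ### From the integral to the discrete Besov norm -/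

section Discretization

variable {n k : ℕ} {u p q α : ℝ} {f f' : EuclideanSpace ℝ (Fin n) → ℝ}

lemma regularOn_volume (n : ℕ) :
    RegularOn (volume : Measure (EuclideanSpace ℝ (Fin n))) univ n
      ((cubeVol n).real univ) ((cubeVol n).real univ) := by
  have hV : 0 < (cubeVol n).real univ :=
    ENNReal.toReal_pos cubeVol_univ_pos.ne' (measure_ne_top _ _)
  have h : ∀ (w : EuclideanSpace ℝ (Fin n)) (r : ℝ), 0 < r →
      volume (cube w r) = ENNReal.ofReal ((cubeVol n).real univ * r ^ (n : ℝ)) := by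
    intro w r hr
    rw [volume_cube w hr, Real.rpow_natCast, ENNReal.ofReal_mul hV.le, mul_comm,
      Measure.real, ENNReal.ofReal_toReal (measure_ne_top _ _)]
  refine ⟨hV, hV, Eventually.of_forall fun _ => mem_univ _, fun w _ r hr _ => (h w r hr).ge,
    fun w _ r hr _ => (h w r hr).le, fun z r hr _ => (h z r hr).le.trans ?_⟩
  gcongr
  linarith

lemma dyadicNorm_succ_le_approxNorm (hu : 1 ≤ u) (hp : 0 < p) (j : ℕ) {t : ℝ}
    (ht : (1 / 2) ^ (j + 1) < t) (ht' : t ≤ (1 / 2) ^ j) :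
    dyadicNorm volume k u p f (j + 1) ≤ 2 ^ n * approxNorm volume k u p f t := by
  have hle : ∀ x, dyadicErr k u f (j + 1) x ≤ 2 ^ n * localApprox volume k u f (cube x t) :=
    fun x => localApprox_le_two_pow_mul hu (half_pow_pos _) ((half_pow_pos _).trans ht)
      (by rw [pow_succ]; linarith) (cube_mono x ht.le)
  calc dyadicNorm volume k u p f (j + 1)
      ≤ (∫⁻ x, (2 ^ n * localApprox volume k u f (cube x t)) ^ p) ^ (1 / p) := by
        rw [dyadicNorm]
        gcongr with x
        exact hle x
    _ = _ := by
        simp_rw [ENNReal.mul_rpow_of_nonneg _ _ hp.le]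
        rw [lintegral_const_mul' _ _ (by finiteness),
          ENNReal.mul_rpow_of_nonneg _ _ (by positivity), ← ENNReal.rpow_mul,
          mul_one_div_cancel hp.ne', ENNReal.rpow_one, approxNorm]

/-- Membership in the Besov space, defined by an integral over the scales, gives a finite discrete
Besov seminorm with the same parameters. -/
lemma discreteBesov_ne_top (hf : Measurable f) (hfp : MemLp f (ENNReal.ofReal p) volume)
    (hu : 1 ≤ u) (hup : u ≤ p) (hq : 1 ≤ q) (hα : 0 < α)
    (hint : ∫⁻ t in Ioc (0 : ℝ) 1,
      (ENNReal.ofReal (t ^ (-α)) * approxNorm volume k u p f t) ^ q * ENNReal.ofReal t⁻¹ < ∞) :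
    discreteBesov volume k u p q α f ≠ ∞ := by
  have hp₀ : 0 < p := by linarith
  have hq₀ : 0 < q := by linarith
  set Φ : ℝ → ℝ≥0∞ := fun t =>
    (ENNReal.ofReal (t ^ (-α)) * approxNorm volume k u p f t) ^ q * ENNReal.ofReal t⁻¹
  set x : ℕ → ℝ≥0∞ := fun j => ENNReal.ofReal (2 ^ ((j : ℝ) * α)) * dyadicNorm volume k u p f j
    with hx
  set I : ℕ → Set ℝ := fun j => Ioc ((1 / 2) ^ (j + 1)) ((1 / 2) ^ j) with hI
  have hd : Pairwise (Function.onFun Disjoint I) :=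
    (antitone_nat_of_succ_le fun j => pow_le_pow_of_le_one (by norm_num) (by norm_num)
      j.le_succ).pairwise_disjoint_on_Ioc_succ
  have hx₀ : x 0 ≠ ∞ := by
    have h₁ := (regularOn_volume n).approxNorm_le (k := k) hf hu hup one_pos le_rfl
    rw [← eLpNorm_ofReal hp₀] at h₁
    have h₂ : x 0 = approxNorm volume k u p f 1 := by
      simp [hx, dyadicNorm, dyadicErr, approxNorm]
    rw [h₂]
    exact ne_top_of_le_ne_top (ENNReal.mul_ne_top
      (ENNReal.rpow_ne_top_of_nonneg (by positivity) ENNReal.ofReal_ne_top) hfp.2.ne) h₁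
  set L : ℝ≥0∞ := (ENNReal.ofReal (2 ^ α) * 2 ^ n) ^ q with hL
  have hLt : L ≠ ∞ := ENNReal.rpow_ne_top_of_nonneg hq₀.le (by finiteness)
  have hstep : ∀ j, x (j + 1) ^ q ≤ L * 2 * ∫⁻ t in I j, Φ t := by
    intro j
    have hpt : ∀ t ∈ I j, x (j + 1) ^ q * ENNReal.ofReal (2 ^ j) ≤ L * Φ t := by
      intro t ht
      have ht₀ : 0 < t := (half_pow_pos _).trans ht.1
      have h₁ := dyadicNorm_succ_le_approxNorm (k := k) (f := f) hu hp₀ j ht.1 ht.2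
      have hinv : (2 : ℝ) ^ j ≤ t⁻¹ := by
        have := (inv_le_inv₀ (half_pow_pos j) ht₀).2 ht.2
        simpa using this
      have h₂ : (2 : ℝ) ^ (((j + 1 : ℕ) : ℝ) * α) ≤ 2 ^ α * t ^ (-α) := by
        rw [Nat.cast_add, Nat.cast_one, add_mul, one_mul, add_comm, Real.rpow_add two_pos,
          Real.rpow_neg ht₀.le, ← Real.inv_rpow ht₀.le, Real.rpow_mul two_pos.le,
          Real.rpow_natCast]
        gcongr
      calc x (j + 1) ^ q * ENNReal.ofReal (2 ^ j)
          ≤ (ENNReal.ofReal (2 ^ α * t ^ (-α)) * (2 ^ n * approxNorm volume k u p f t)) ^ q *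
            ENNReal.ofReal t⁻¹ := by
            simp only [hx]
            gcongr
        _ = (ENNReal.ofReal (2 ^ α) * 2 ^ n *
            (ENNReal.ofReal (t ^ (-α)) * approxNorm volume k u p f t)) ^ q *
            ENNReal.ofReal t⁻¹ := by
            rw [ENNReal.ofReal_mul (by positivity)]
            congr 2
            ring
        _ = _ := by rw [ENNReal.mul_rpow_of_nonneg _ _ hq₀.le, mul_assoc]
    have hvol : ENNReal.ofReal (2 ^ j) * volume (I j) * 2 = 1 := by
      rw [Real.volume_Ioc, ← ENNReal.ofReal_ofNat 2, ← ENNReal.ofReal_mul (by positivity),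
        ← ENNReal.ofReal_mul' (by norm_num), ← ENNReal.ofReal_one]
      congr 1
      rw [pow_succ, one_div, inv_pow]
      field_simp
      norm_num
    have hmono : x (j + 1) ^ q * ENNReal.ofReal (2 ^ j) * volume (I j) ≤ L * ∫⁻ t in I j, Φ t := by
      rw [← setLIntegral_const, ← lintegral_const_mul' _ _ hLt]
      exact setLIntegral_mono' measurableSet_Ioc hpt
    calc x (j + 1) ^ q = x (j + 1) ^ q * ENNReal.ofReal (2 ^ j) * volume (I j) * 2 := by
          rw [mul_assoc, mul_assoc, ← mul_assoc (ENNReal.ofReal _), hvol, mul_one]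
      _ ≤ L * (∫⁻ t in I j, Φ t) * 2 := by gcongr
      _ = _ := by ring
  have htsum : ∑' j, x (j + 1) ^ q ≠ ∞ := by
    refine ne_top_of_le_ne_top ?_ (ENNReal.tsum_le_tsum hstep)
    rw [ENNReal.tsum_mul_left, ← lintegral_iUnion (fun j => measurableSet_Ioc) hd]
    refine ENNReal.mul_ne_top (by finiteness) (ne_top_of_le_ne_top hint.ne ?_)
    refine lintegral_mono_set (iUnion_subset fun j t ht => ?_)
    exact ⟨(half_pow_pos _).trans ht.1, ht.2.trans (half_pow_le_one j)⟩
  rw [discreteBesov_volume_eq]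
  exact ne_top_of_le_ne_top (ENNReal.add_ne_top.2
    ⟨hx₀, ENNReal.rpow_ne_top_of_nonneg (by positivity) htsum⟩) (tsum_rpow_le_zero_add hq x)

lemma approxNorm_congr_ae (h : f =ᵐ[volume] f') (t : ℝ) :
    approxNorm volume k u p f t = approxNorm volume k u p f' t := by
  simp only [approxNorm, localApprox_congr_ae h]

lemma hasTraceAt_congr_ae (h : f =ᵐ[volume] f') (x : EuclideanSpace ℝ (Fin n)) (l : ℝ) :
    HasTraceAt f x l ↔ HasTraceAt f' x l := by
  have : ∀ r, ⨍ y in cube x r, f y = ⨍ y in cube x r, f' y := fun r =>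
    average_congr (ae_restrict_of_ae h)
  simp only [HasTraceAt, this]

lemma trace_congr_ae (h : f =ᵐ[volume] f') : trace f = trace f' := by
  ext x
  have hx : HasTraceAt f x = HasTraceAt f' x :=
    funext fun l => propext (hasTraceAt_congr_ae h x l)
  unfold trace
  rw [hx]

end Discretization

theorem theorem4p1 (n : ℕ) (d : ℝ) (hd₁ : (n : ℝ) - 1 < d) (hd₂ : d < n)
    (S : Set (EuclideanSpace ℝ (Fin n))) (hS : IsDSet d S)
    (p q α u : ℝ) (k : ℕ) (hp : 1 ≤ p) (hq : 1 ≤ q) (hα : ((n : ℝ) - d) / p < α)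
    (hu₁ : 1 ≤ u) (hu₂ : u ≤ p) (hk : α < k) :
    ∃ C : ℝ, 0 < C ∧ ∀ f : EuclideanSpace ℝ (Fin n) → ℝ, MemBesov α p q f →
      (∀ᵐ x ∂(setMeasure d S), ∃ l, HasTraceAt f x l) ∧
      MemLp (trace f) (ENNReal.ofReal p) (setMeasure d S) ∧
      discreteBesov (setMeasure d S) k u p q (α - ((n : ℝ) - d) / p) (trace f)
          + eLpNorm (trace f) (ENNReal.ofReal p) (setMeasure d S)
        ≤ ENNReal.ofReal C *
          (discreteBesov volume k u p q α f + eLpNorm f (ENNReal.ofReal p) volume) := by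
  have hσ := hS.sigmaFinite
  obtain ⟨c₁, c₂, h⟩ := hS.exists_regularOn
  have hα₀ : 0 < α := lt_of_le_of_lt (div_nonneg (by linarith) (by linarith)) hα
  obtain ⟨C, hC, hbound⟩ := h.trace_bound (q := q) k hu₁ hu₂ hq hα
  refine ⟨C.toReal + 1, by positivity, fun f₀ ⟨hfp₀, k', u', _, hu'₁, hu'₂, hint⟩ => ?_⟩
  -- Traces and local approximations do not change if `f₀` is replaced by a Borel representative.
  set f := hfp₀.1.mk f₀
  have hae : f₀ =ᵐ[volume] f := hfp₀.1.ae_eq_mk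
  have hf : Measurable f := hfp₀.1.stronglyMeasurable_mk.measurable
  have hfp : MemLp f (ENNReal.ofReal p) volume := (memLp_congr_ae hae).1 hfp₀
  simp only [approxNorm_congr_ae hae] at hint
  have hbes : discreteBesov volume k u p q α f₀ = discreteBesov volume k u p q α f := by
    simp only [discreteBesov, approxNorm_congr_ae hae]
  simp only [hasTraceAt_congr_ae hae, trace_congr_ae hae, hbes, eLpNorm_congr_ae hae]
  -- The parameters `k'`, `u'` for which the Besov norm is known to be finite give existence; the
  -- inequality for `k`, `u` is trivial if its right-hand side is infinite.
  obtain ⟨C', -, hbound'⟩ := h.trace_bound (q := q) k' hu'₁ hu'₂ hq hα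
  obtain ⟨h₁, h₂, -⟩ := hbound' f hf hfp (discreteBesov_ne_top hf hfp hu'₁ hu'₂ hq hα₀ hint)
  refine ⟨h₁, h₂, ?_⟩
  obtain htop | hfin := eq_or_ne (discreteBesov volume k u p q α f) ∞
  · rw [htop, top_add, ENNReal.mul_top (by simp; positivity)]
    exact le_top
  · refine (hbound f hf hfp hfin).2.2.trans ?_
    gcongr
    rw [← ENNReal.ofReal_toReal hC]
    exact ENNReal.ofReal_le_ofReal (by simp)
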